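/- Let $D$ be a division algebra of degree $d$ over its center $C$ (so $[D:C]=d^2$), let $\sigma$ be an automorphism of $D$ of finite order $n$ modulo inner automorphisms, with $\sigma^n(z)=uzu^{-1}$ for all $z \in D$, where $u\in D^\times$ and $\sigma(u)=u$. Let $R=D[t;\sigma]$ be the skew polynomial ring (with $ta=\sigma(a)t$) and $F=C\cap\mathrm{Fix}(\sigma)$. Let $f\in R$ be monic and irreducible of degree $m>1$ with greatest common right divisor $(f,t)_r=1$, and let $h$ be its minimal central left multiple, i.e. the element of minimal degree in the center of $R$ which is a left multiple of $f$ and has the form $h(t)=\hat h(u^{-1}t^n)$ with $\hat h\in F[x]$ monic. Let $S_f$ be the Petit algebra of $f$, i.e. $\{g\in R : \deg g<m\}\cong R/Rf$ with the product $a\circ b = ab \bmod_r f$ (remainder of right division by $f$), let $B=\mathrm{Nuc}_r(S_f)=\{z\in S_f : (x\circ y)\circ z=x\circ(y\circ z)\text{ for all }x,y \in S_f\}$ be its right nucleus, and regard $V_f=R/Rf\cong S_f$ as a right $B$-module by right multiplication in $S_f$. Suppose that $\deg(h)=km$. Then $V_f$ has a right $B$-basis of $k$ elements. Fix any such basis,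 and for $a\in R$ let $M_a\in M_k(B)$ be the matrix, with respect to this basis, of the left multiplication $V_f\to V_f$, $b+Rf\mapsto ab+Rf$. Then $a+Rh\mapsto M_a$ is a well-defined ring isomorphism $R/Rh\to M_k(B)$. For every $a\in R$ a greatest common right divisor $\mathrm{gcrd}(a,h)$ exists, and the right $B$-linear map $L_{M_a}:M_k(B)\to M_k(B)$, $X\mapsto M_aX$, satisfies $$\dim_B(\mathrm{im}\,L_{M_a})=k^2-\frac{k}{m}\deg(\mathrm{gcrd}(a,h)),\qquad \mathrm{colrank}(M_a)=k-\frac1m\deg(\mathrm{gcrd}(a,h)),$$ where $\mathrm{colrank}(M_a)$ is the rank of the right $B$-module generated by the columns of $M_a$. In particular, if $\deg(h)=dmn$, then $k=dn$, the map $p(x)\mapsto p(u^{-1}t^n)+Rf$ induces an isomorphism of $E_{\hat h}=F[x]/(\hat h(x))$ onto $B$, so that $M_a$ becomes a matrix in $M_{dn}(E_{\hat h})$, and $$\mathrm{rank}(M_a)=dn-\frac1m\deg(\mathrm{gcrd}(a,h)).$$ -/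

import Mathlib

noncomputable section

namespace SkewRank

open SkewPolynomial

/-! ### Degrees, divisibility and right division in `D[t;σ]`

`SkewPolynomial D` is `D[t;σ]` (coefficients on the left, `t * a = σ a * t`), where
`σ a = Multiplicative.ofAdd 1 • a`. -/

section Degree

variable {D : Type*} [DivisionRing D]

/-- The degree of a skew polynomial, with `deg 0 = ⊥`. -/
def deg (p : SkewPolynomial D) : WithBot ℕ := p.support.max

/-- The degree of a skew polynomial as a natural number (`0` for the zero polynomial). -/
def natDeg (p : SkewPolynomial D) : ℕ := (deg p).unbotD 0

/-- A skew polynomial is monic if its leading coefficient is `1`. -/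
def IsMonic (p : SkewPolynomial D) : Prop := p.coeff (natDeg p) = 1

lemma deg_lt_iff (p : SkewPolynomial D) (m : ℕ) :
    deg p < m ↔ ∀ i, m ≤ i → p.coeff i = 0 := by
  unfold deg
  have hb : (⊥ : WithBot ℕ) < (m : WithBot ℕ) := WithBot.bot_lt_coe m
  rw [Finset.max_eq_sup_withBot]
  have key : p.support.sup WithBot.some < (m : WithBot ℕ) ↔
      ∀ i ∈ p.support, (WithBot.some i : WithBot ℕ) < (m : WithBot ℕ) := Finset.sup_lt_iff hb
  refine key.trans ?_
  constructor
  · intro h i hi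
    by_contra hc
    have h2 : i < m := WithBot.coe_lt_coe.mp (h i (mem_support_iff.mpr hc))
    omega
  · intro h i hi
    refine WithBot.coe_lt_coe.mpr ?_
    by_contra hc
    exact (mem_support_iff.mp hi) (h i (Nat.le_of_not_lt hc))

lemma IsMonic.ne_zero {f : SkewPolynomial D} (hf : IsMonic f) : f ≠ 0 := by
  rintro rfl
  simp [IsMonic] at hf

lemma deg_eq_natDeg {p : SkewPolynomial D} (hp : p ≠ 0) : deg p = (natDeg p : WithBot ℕ) := by
  have hne : p.support.Nonempty := by
    rw [Finset.nonempty_iff_ne_empty]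
    simpa using hp
  obtain ⟨b, hb⟩ := Finset.max_of_nonempty hne
  have hb' : deg p = (b : WithBot ℕ) := hb
  simp [natDeg, hb']

lemma coeff_natDeg_ne_zero {p : SkewPolynomial D} (hp : p ≠ 0) : p.coeff (natDeg p) ≠ 0 :=
  mem_support_iff.mp (Finset.mem_of_max (deg_eq_natDeg hp))

lemma coeff_eq_zero_of_natDeg_lt {p : SkewPolynomial D} {i : ℕ} (h : natDeg p < i) :
    p.coeff i = 0 := by
  by_cases hp : p = 0
  · simp [hp]
  · refine (deg_lt_iff p i).mp ?_ i le_rfl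
    rw [deg_eq_natDeg hp]
    exact_mod_cast h

variable [MulSemiringAction (Multiplicative ℕ) D]

lemma coeff_monomial_mul (i j : ℕ) (a : D) (f : SkewPolynomial D) :
    (monomial i a * f).coeff j = if i ≤ j then a * φ^[i] (f.coeff (j - i)) else 0 := by
  induction f using SkewPolynomial.induction with
  | h0 => simp
  | ha n r q _ _ hq =>
    rw [mul_add, coeff_add, hq, monomial_mul_monomial, coeff_monomial, coeff_add, coeff_monomial]
    by_cases hij : i ≤ j
    · by_cases h2 : i + n = j
      · have h3 : n = j - i := by omega
        simp [hij, h3, iterate_map_add, mul_add]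
      · have h3 : ¬ n = j - i := by omega
        simp [hij, h2, h3]
    · have h2 : ¬ i + n = j := by omega
      simp [hij, h2]

lemma coeff_mul_top (q f : SkewPolynomial D) (hf : IsMonic f) :
    (q * f).coeff (natDeg q + natDeg f) = q.coeff (natDeg q) := by
  have hq : q * f = ∑ i ∈ q.support, monomial i (q.coeff i) * f := by
    rw [← Finset.sum_mul, ← sum_def, sum_monomial]
  rw [hq]
  have hsum : ∀ s : Finset ℕ, ∀ g : ℕ → SkewPolynomial D, ∀ j,
      (∑ i ∈ s, g i).coeff j = ∑ i ∈ s, (g i).coeff j := by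
    intro s g j
    induction s using Finset.induction_on with
    | empty => simp
    | insert a s ha ih => rw [Finset.sum_insert ha, Finset.sum_insert ha, coeff_add, ih]
  rw [hsum, Finset.sum_eq_single (natDeg q)]
  · rw [coeff_monomial_mul]
    have hf' : f.coeff (natDeg f) = 1 := hf
    simp [hf', iterate_map_one]
  · intro i hi hne
    rw [coeff_monomial_mul]
    have h1 : i < natDeg q := by
      by_contra hc
      exact (mem_support_iff.mp hi) (coeff_eq_zero_of_natDeg_lt (by omega))
    rw [coeff_eq_zero_of_natDeg_lt (p := f) (by omega)]
    simp
  · intro hi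
    rw [notMem_support_iff.mp hi]
    simp

/-- A left multiple of a monic `f` of degree less than `deg f` vanishes. -/
lemma eq_zero_of_deg_lt {f : SkewPolynomial D} (hf : IsMonic f) {r : SkewPolynomial D}
    (hr : r ∈ Ideal.span {f}) (hd : deg r < deg f) : r = 0 := by
  obtain ⟨q, rfl⟩ := Ideal.mem_span_singleton'.mp hr
  by_cases hq : q = 0
  · simp [hq]
  · rw [deg_eq_natDeg hf.ne_zero, deg_lt_iff] at hd
    exact absurd ((coeff_mul_top q f hf).symm.trans (hd _ (by omega))) (coeff_natDeg_ne_zero hq)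

/-- Right division with remainder by a monic skew polynomial. -/
lemma exists_rem {f : SkewPolynomial D} (hf : IsMonic f) (g : SkewPolynomial D) :
    ∃ r, deg r < deg f ∧ g - r ∈ Ideal.span {f} := by
  rw [deg_eq_natDeg hf.ne_zero]
  have key : ∀ N : ℕ, ∀ g : SkewPolynomial D, (∀ i, N ≤ i → g.coeff i = 0) →
      ∃ r, deg r < (natDeg f : WithBot ℕ) ∧ g - r ∈ Ideal.span {f} := by
    intro N
    induction N with
    | zero =>
      intro g hg
      refine ⟨g, (deg_lt_iff _ _).mpr fun i _ => hg i (Nat.zero_le i), by simp⟩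
    | succ N ih =>
      intro g hg
      by_cases hN : N < natDeg f
      · exact ⟨g, (deg_lt_iff _ _).mpr fun i hi => hg i (by omega), by simp⟩
      · have hf' : f.coeff (natDeg f) = 1 := hf
        have hc : ∀ i, N ≤ i →
            (g + monomial (N - natDeg f) (-(g.coeff N)) * f).coeff i = 0 := by
          intro i hi
          rw [coeff_add, coeff_monomial_mul, if_pos (by omega)]
          rcases Nat.eq_or_lt_of_le hi with h | h
          · subst h
            rw [show N - (N - natDeg f) = natDeg f by omega, hf', iterate_map_one]
            simp
          · rw [hg i (by omega), coeff_eq_zero_of_natDeg_lt (p := f) (by omega)]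
            simp
        obtain ⟨r, hr, hmem⟩ := ih _ hc
        refine ⟨r, hr, ?_⟩
        have h2 : monomial (N - natDeg f) (-(g.coeff N)) * f ∈ Ideal.span {f} :=
          Ideal.mem_span_singleton'.mpr ⟨_, rfl⟩
        have h3 := sub_mem hmem h2
        have h4 : g + monomial (N - natDeg f) (-(g.coeff N)) * f - r
            - monomial (N - natDeg f) (-(g.coeff N)) * f = g - r := by abel
        rwa [h4] at h3
  exact key (natDeg g + 1) g fun i hi => coeff_eq_zero_of_natDeg_lt (by omega)

end Degree

section Gcrd

variable {D : Type*} [DivisionRing D] [MulSemiringAction (Multiplicative ℕ) D]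

/-- `g` is a right divisor of `a`. -/
def RightDvd (g a : SkewPolynomial D) : Prop := ∃ q, a = q * g

/-- `g` is a greatest common right divisor of `a` and `b`. -/
def IsGCRD (g a b : SkewPolynomial D) : Prop :=
  RightDvd g a ∧ RightDvd g b ∧ ∀ e, RightDvd e a → RightDvd e b → RightDvd e g

end Gcrd

/-! ### The right nucleus of a nonassociative ring -/

section Nucleus

variable (S : Type*) [NonAssocRing S]

/-- The right nucleus `Nuc_r(S) = {z | (x y) z = x (y z) for all x, y}`. -/
def rightNucleus : NonUnitalSubring S where
  carrier := {z | ∀ x y : S, (x * y) * z = x * (y * z)}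
  add_mem' := by
    intro a b ha hb x y
    rw [mul_add, ha x y, hb x y, mul_add, mul_add]
  zero_mem' := by intro x y; simp
  neg_mem' := by
    intro a ha x y
    rw [mul_neg, ha x y, mul_neg, mul_neg]
  mul_mem' := by
    intro a b ha hb x y
    rw [← hb (x * y) a, ha x y, hb x (y * a), hb y a]

instance : One (rightNucleus S) := ⟨⟨1, fun x y => by simp⟩⟩

instance rightNucleus.instRing : Ring (rightNucleus S) :=
  { (inferInstance : NonUnitalNonAssocRing (rightNucleus S)) with
    one := 1
    one_mul := fun a => Subtype.ext (one_mul (a : S))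
    mul_one := fun a => Subtype.ext (mul_one (a : S))
    mul_assoc := fun a b c => Subtype.ext (c.2 (a : S) (b : S)) }

/-- Every nonassociative ring is a right module over its right nucleus, by right
multiplication. -/
instance rightNucleus.instModule : Module (rightNucleus S)ᵐᵒᵖ S where
  smul z x := x * (z.unop : S)
  one_smul x := mul_one x
  mul_smul z w x := (z.unop.2 x (w.unop : S)).symm
  smul_zero _ := zero_mul _
  smul_add _ _ _ := add_mul _ _ _
  add_smul _ _ _ := mul_add _ _ _
  zero_smul x := mul_zero x

end Nucleus

/-! ### The Petit algebra `S_f` on `V_f = R/Rf` -/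

section Petit

variable {D : Type*} [DivisionRing D] [MulSemiringAction (Multiplicative ℕ) D]

/-- The left `R`-module `V_f = R/Rf`; it is also the underlying module of the Petit algebra `S_f`,
since every class has exactly one representative of degree less than `deg f`. -/
def PetitAlgebra (f : SkewPolynomial D) (_hf : IsMonic f) : Type _ :=
  SkewPolynomial D ⧸ Ideal.span {f}

namespace PetitAlgebra

variable (f : SkewPolynomial D) (hf : IsMonic f)

instance : AddCommGroup (PetitAlgebra f hf) :=
  inferInstanceAs (AddCommGroup (SkewPolynomial D ⧸ Ideal.span {f}))

/-- Left multiplication of `R` on `R/Rf`: `a • (b + Rf) = ab + Rf`. -/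
instance : Module (SkewPolynomial D) (PetitAlgebra f hf) :=
  inferInstanceAs (Module (SkewPolynomial D) (SkewPolynomial D ⧸ Ideal.span {f}))

/-- The class `a + Rf`. -/
def mk : SkewPolynomial D →ₗ[SkewPolynomial D] PetitAlgebra f hf :=
  Submodule.mkQ (Ideal.span {f})

lemma mk_surjective : Function.Surjective (mk f hf) := Submodule.mkQ_surjective _

lemma mk_eq_zero {a : SkewPolynomial D} : mk f hf a = 0 ↔ a ∈ Ideal.span {f} :=
  Submodule.Quotient.mk_eq_zero _

lemma exists_rep (x : PetitAlgebra f hf) : ∃ r, deg r < deg f ∧ mk f hf r = x := by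
  obtain ⟨g, rfl⟩ := mk_surjective f hf x
  obtain ⟨r, hr, hm⟩ := exists_rem hf g
  refine ⟨r, hr, ?_⟩
  have := (mk_eq_zero f hf).mpr hm
  rw [map_sub, sub_eq_zero] at this
  exact this.symm

/-- The representative of degree less than `deg f` of a class in `R/Rf`, i.e. the remainder of
right division by `f` of any of its elements. -/
def rep (x : PetitAlgebra f hf) : SkewPolynomial D := (exists_rep f hf x).choose

lemma deg_rep (x : PetitAlgebra f hf) : deg (rep f hf x) < deg f :=
  (exists_rep f hf x).choose_spec.1

lemma mk_rep (x : PetitAlgebra f hf) : mk f hf (rep f hf x) = x :=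
  (exists_rep f hf x).choose_spec.2

lemma rep_unique {x : PetitAlgebra f hf} {r : SkewPolynomial D} (hr : deg r < deg f)
    (hx : mk f hf r = x) : rep f hf x = r := by
  have h1 : rep f hf x - r ∈ Ideal.span {f} := by
    rw [← mk_eq_zero f hf, map_sub, mk_rep, hx, sub_self]
  refine sub_eq_zero.mp (eq_zero_of_deg_lt hf h1 ?_)
  have h2 := deg_rep f hf x
  rw [deg_eq_natDeg hf.ne_zero, deg_lt_iff] at *
  intro i hi
  rw [sub_eq_add_neg, coeff_add, h2 i hi]
  have : (-r).coeff i = 0 := by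
    have h3 := coeff_add r (-r) i
    rw [add_neg_cancel, coeff_zero, hr i hi, zero_add] at h3
    exact h3.symm
  rw [this, add_zero]

lemma rep_add (x y : PetitAlgebra f hf) :
    rep f hf (x + y) = rep f hf x + rep f hf y := by
  refine rep_unique f hf ?_ (by rw [map_add, mk_rep, mk_rep])
  have h1 := deg_rep f hf x
  have h2 := deg_rep f hf y
  rw [deg_eq_natDeg hf.ne_zero, deg_lt_iff] at *
  intro i hi
  rw [coeff_add, h1 i hi, h2 i hi, add_zero]

lemma rep_zero : rep f hf 0 = 0 :=
  rep_unique f hf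
    (by rw [deg_eq_natDeg hf.ne_zero, deg_lt_iff]; intro i _; simp) (map_zero _)

/-- The product of `S_f`: multiply the representatives of degree less than `deg f` in `R` and
reduce modulo `Rf`. -/
instance : Mul (PetitAlgebra f hf) := ⟨fun x y => mk f hf (rep f hf x * rep f hf y)⟩

lemma mul_def (x y : PetitAlgebra f hf) : x * y = mk f hf (rep f hf x * rep f hf y) := rfl

lemma mul_eq_smul (x y : PetitAlgebra f hf) : x * y = rep f hf x • y := by
  rw [mul_def, ← smul_eq_mul, map_smul, mk_rep]

instance : One (PetitAlgebra f hf) := ⟨mk f hf 1⟩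

lemma one_def : (1 : PetitAlgebra f hf) = mk f hf 1 := rfl

lemma one_mul' (x : PetitAlgebra f hf) : 1 * x = x := by
  rw [mul_eq_smul]
  by_cases hm : natDeg f = 0
  · have h0 : x = 0 := by
      have h := deg_rep f hf x
      rw [deg_eq_natDeg hf.ne_zero, hm, deg_lt_iff] at h
      have h1 : rep f hf x = 0 := by
        ext i
        simpa using h i (Nat.zero_le i)
      rw [← mk_rep f hf x, h1, map_zero]
    rw [h0, smul_zero]
  · have h1 : rep f hf 1 = 1 := by
      refine rep_unique f hf ?_ rfl
      rw [deg_eq_natDeg hf.ne_zero, deg_lt_iff]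
      intro i hi
      rw [coeff_one, if_neg (by omega)]
    rw [h1, one_smul]

instance : NonAssocRing (PetitAlgebra f hf) :=
  { (inferInstance : AddCommGroup (PetitAlgebra f hf)) with
    mul := (· * ·)
    one := 1
    left_distrib := fun x y z => by
      change x * (y + z) = x * y + x * z
      rw [mul_eq_smul, mul_eq_smul, mul_eq_smul, smul_add]
    right_distrib := fun x y z => by
      change (x + y) * z = x * z + y * z
      rw [mul_eq_smul, mul_eq_smul, mul_eq_smul, rep_add, add_smul]
    zero_mul := fun x => by
      change 0 * x = 0
      rw [mul_eq_smul, rep_zero, zero_smul]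
    mul_zero := fun x => by
      change x * 0 = 0
      rw [mul_eq_smul, smul_zero]
    one_mul := one_mul' f hf
    mul_one := fun x => by
      change x * 1 = x
      rw [mul_eq_smul, one_def, ← map_smul, smul_eq_mul, mul_one, mk_rep] }

end PetitAlgebra

/-- The right nucleus `B = Nuc_r(S_f)` of the Petit algebra. -/
abbrev NucR (f : SkewPolynomial D) (hf : IsMonic f) : Type _ := rightNucleus (PetitAlgebra f hf)

/-- The matrix `M_a ∈ M_k(B)` of the left multiplication `L_a : V_f → V_f`,
`b + Rf ↦ ab + Rf`, with respect to a right `B`-basis `e` of `V_f`: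
`L_a(e_j) = ∑ i, e_i (M_a)_{ij}`. -/
def leftMulMatrix {f : SkewPolynomial D} {hf : IsMonic f} {k : ℕ}
    (e : Module.Basis (Fin k) (NucR f hf)ᵐᵒᵖ (PetitAlgebra f hf)) (a : SkewPolynomial D) :
    Matrix (Fin k) (Fin k) (NucR f hf) :=
  Matrix.of fun i j => (e.repr (a • e j) i).unop

end Petit

/-! ### Ranks over a noncommutative ring -/

section Rank

variable {B : Type*} [Ring B] {k : ℕ}

/-- The column rank: the rank of the right `B`-module generated by the columns. -/
def colRank (A : Matrix (Fin k) (Fin k) B) : ℕ :=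
  Module.finrank Bᵐᵒᵖ (Submodule.span Bᵐᵒᵖ (Set.range A.col))

/-- The right `B`-linear map `L_A : M_k(B) → M_k(B)`, `X ↦ A X`. -/
def mulLeftMap (A : Matrix (Fin k) (Fin k) B) :
    Matrix (Fin k) (Fin k) B →ₗ[Bᵐᵒᵖ] Matrix (Fin k) (Fin k) B where
  toFun X := A * X
  map_add' X Y := Matrix.mul_add A X Y
  map_smul' c X := Matrix.mul_smul A c X

end Rank

/-! ### The minimal central left multiple -/

section Mclm

variable {D : Type*} [DivisionRing D]

/-- The field `F = C ∩ Fix(σ)`, where `C` is the center of `D`. -/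
def fixedCenter (σ : D ≃+* D) : Subfield (Subring.center D) where
  carrier := {c | σ (c : D) = c}
  mul_mem' := by intro a b ha hb; simp_all
  one_mem' := by simp
  add_mem' := by intro a b ha hb; simp_all
  zero_mem' := by simp
  neg_mem' := by intro a ha; simp_all
  inv_mem' := by
    intro a ha
    have h : (((a⁻¹ : Subring.center D)) : D) = (a : D)⁻¹ := by
      by_cases h0 : a = 0
      · simp [h0]
      · have h0' : (a : D) ≠ 0 := fun h => h0 (Subtype.ext h)
        refine eq_inv_of_mul_eq_one_left ?_
        have := congrArg (Subtype.val) (inv_mul_cancel₀ h0)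
        simpa using this
    simp only [Set.mem_ofPred_eq] at ha ⊢
    rw [h, map_inv₀, ha]

variable [MulSemiringAction (Multiplicative ℕ) D]

/-- The element `p(u⁻¹ tⁿ)` of `R = D[t;σ]` for a polynomial `p(x) ∈ F[x]`. -/
def evalCentral (σ : D ≃+* D) (n : ℕ) (u : D) (p : Polynomial (fixedCenter σ)) :
    SkewPolynomial D :=
  p.eval₂ ((CRingHom.comp (Subring.center D).subtype).comp (fixedCenter σ).subtype)
    (C u⁻¹ * X ^ n)

/-- `h = ĥ(u⁻¹ tⁿ)` with `ĥ ∈ F[x]` monic is the minimal central left multiple of `f`: it is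
central, a left multiple of `f`, and of minimal degree among all such elements. -/
structure IsMclm (σ : D ≃+* D) (n : ℕ) (u : D) (f : SkewPolynomial D)
    (h : Subring.center (SkewPolynomial D)) (hhat : Polynomial (fixedCenter σ)) : Prop where
  monic : hhat.Monic
  eq_eval : (h : SkewPolynomial D) = evalCentral σ n u hhat
  rightDvd : RightDvd f (h : SkewPolynomial D)
  minimal : ∀ (h' : Subring.center (SkewPolynomial D)) (hhat' : Polynomial (fixedCenter σ)),
    hhat'.Monic → (h' : SkewPolynomial D) = evalCentral σ n u hhat' →
    RightDvd f (h' : SkewPolynomial D) → deg (h : SkewPolynomial D) ≤ deg (h' : SkewPolynomial D)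

end Mclm

/-- The left ideal generated by a central element is two-sided, so `R/Rh` is a ring. -/
instance isTwoSided_span_center {R : Type*} [Ring R] (h : Subring.center R) :
    (Ideal.span {(h : R)}).IsTwoSided where
  mul_mem_of_left := by
    intro a b ha
    obtain ⟨c, rfl⟩ := Ideal.mem_span_singleton'.mp ha
    refine Ideal.mem_span_singleton'.mpr ⟨c * b, ?_⟩
    rw [mul_assoc, mul_assoc, Subring.mem_center_iff.mp h.2 b]

end SkewRank

end

noncomputable section

namespace SkewRank

/-! ### Simple modules and their commuting division ring -/

section Density

variable {A K V : Type*} [Ring A] [AddCommGroup V] [Module A V]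

/-! Write R for D[t;σ] and V for V_f = R/Rf. Left ideals of R are principal, so irreducibility of f
makes V a simple left R-module. Its R-endomorphisms are exactly the right multiplications by
elements of B = Nuc_r(S_f) (`exists_nucleus_of_linearMap`), so B is a division ring by Schur's
lemma. By Jacobson density R sends finitely many B-independent vectors to arbitrary targets
(`exists_smul_eq_of_linearIndependent`). The annihilator of V is a two-sided ideal whose generator
is, up to a constant, a polynomial in u⁻¹tⁿ; minimality of h identifies it with Rh
(`smul_eq_zero_iff_mem_span`). Together these give R/Rh ≅ End_B(V) ≅ M_k(B).

All ranks come from one count over D. If w_1, ..., w_s are B-independent and Rg is their common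
annihilator, density gives R/Rg ≅ V^s, hence sm = deg g (`mul_natDeg_eq_of_linearIndependent`). A
basis of V has annihilator Rh, which gives dim_B V = k. A basis of the kernel of a has annihilator
Ra + Rh = R gcrd(a,h) (`kills_ker_iff`, `IsGCRD.span_eq`), so the kernel has dimension
deg(gcrd(a,h))/m. Rank-nullity gives the column rank, and X ↦ M_a X has k copies of the image of a
as its image.

When deg h = dmn, the map p ↦ p(u⁻¹tⁿ) + Rf embeds F[x]/(ĥ) in B. Computing dim_F V through D and
through B shows [B:F] ≤ deg ĥ, so the embedding is onto. -/

lemma isUnit_or_eq_zero_of_commutant [Ring K] [Module K V] [SMulCommClass A K V]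
    [FaithfulSMul K V] [IsSimpleModule A V]
    (hK : ∀ φ : V →ₗ[A] V, ∃ c : K, ∀ v, φ v = c • v) (c : K) : IsUnit c ∨ c = 0 := by
  -- Schur: `c` acts as an endomorphism that is zero or bijective. In the second case the inverse
  -- map is again a scalar by `hK`, and faithfulness turns this into an inverse of `c` in `K`.
  let φ : V →ₗ[A] V :=
    { toFun := fun v => c • v
      map_add' := smul_add c
      map_smul' := fun a v => (smul_comm a c v).symm }
  rcases LinearMap.bijective_or_eq_zero φ with h | h
  · left
    let ψ := LinearEquiv.ofBijective φ h
    obtain ⟨c', hc'⟩ := hK ψ.symm.toLinearMap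
    have h1 : ∀ v, c • c' • v = v := fun v => by
      rw [← hc' v]
      exact ψ.apply_symm_apply v
    have h2 : ∀ v, c' • c • v = v := fun v => by
      rw [← hc' (c • v)]
      exact ψ.symm_apply_apply v
    refine ⟨⟨c, c', ?_, ?_⟩, rfl⟩
    · exact FaithfulSMul.eq_of_smul_eq_smul (α := V) fun v => by rw [mul_smul, h1, one_smul]
    · exact FaithfulSMul.eq_of_smul_eq_smul (α := V) fun v => by rw [mul_smul, h2, one_smul]
  · right
    refine FaithfulSMul.eq_of_smul_eq_smul (α := V) fun v => ?_
    rw [zero_smul]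
    exact DFunLike.congr_fun h v

variable [DivisionRing K] [Module K V] [IsSimpleModule A V]

/-- Since every A-endomorphism is a scalar from `K`, a K-linear map commutes with all of `End_A V`.
It therefore lies in the bicommutant of `A`, where Jacobson density applies. -/
lemma exists_smul_eq_on_finset (hK : ∀ φ : V →ₗ[A] V, ∃ c : K, ∀ v, φ v = c • v)
    (f : V →ₗ[K] V) (s : Finset V) : ∃ a : A, ∀ v ∈ s, f v = a • v := by
  let g : Module.End (Module.End A V) V :=
    { toFun := f
      map_add' := map_add f
      map_smul' := fun φ v => by
        obtain ⟨c, hc⟩ := hK φ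
        change f (φ v) = φ (f v)
        rw [hc, hc, map_smul] }
  exact jacobson_density g s

lemma exists_smul_eq_of_linearIndependent
    (hK : ∀ φ : V →ₗ[A] V, ∃ c : K, ∀ v, φ v = c • v) {ι : Type*} [Finite ι] {w : ι → V}
    (hw : LinearIndependent K w) (t : ι → V) : ∃ a : A, ∀ i, a • w i = t i := by
  classical
  cases nonempty_fintype ι
  obtain ⟨f, hf⟩ := LinearMap.exists_extend
    ((Module.Basis.span hw).constr ℕ t : Submodule.span K (Set.range w) →ₗ[K] V)
  obtain ⟨a, ha⟩ := exists_smul_eq_on_finset hK f (Finset.univ.image w)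
  refine ⟨a, fun i => ?_⟩
  rw [← ha (w i) (Finset.mem_image_of_mem w (Finset.mem_univ i))]
  have h1 := DFunLike.congr_fun hf (Module.Basis.span hw i)
  rw [Module.Basis.constr_basis] at h1
  rw [← h1, LinearMap.comp_apply, Submodule.subtype_apply, Module.Basis.span_apply]

lemma exists_smul_eq_linearMap [SMulCommClass A K V] [Module.Finite K V]
    (hK : ∀ φ : V →ₗ[A] V, ∃ c : K, ∀ v, φ v = c • v) (f : V →ₗ[K] V) :
    ∃ a : A, ∀ v, a • v = f v := by
  let b := Module.finBasis K V
  obtain ⟨a, ha⟩ := exists_smul_eq_of_linearIndependent hK b.linearIndependent (f ∘ b)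
  refine ⟨a, fun v => ?_⟩
  have h : DistribSMul.toLinearMap K V a = f := b.ext ha
  exact DFunLike.congr_fun h v

/-- ψ factors through V/ker φ ≅ im φ, and a linear map on a subspace extends to V over a division
ring. -/
lemma exists_comp_eq_of_ker_le {φ ψ : V →ₗ[K] V} (h : LinearMap.ker φ ≤ LinearMap.ker ψ) :
    ∃ Y : V →ₗ[K] V, ∀ v, Y (φ v) = ψ v := by
  obtain ⟨Y, hY⟩ := LinearMap.exists_extend
    ((LinearMap.ker φ).liftQ ψ h ∘ₗ φ.quotKerEquivRange.symm.toLinearMap)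
  refine ⟨Y, fun v => ?_⟩
  have h1 := DFunLike.congr_fun hY (φ.quotKerEquivRange ((LinearMap.ker φ).mkQ v))
  simpa using h1

/-- An element kills the kernel of `a` iff it is a left multiple of `a` up to an element that
annihilates the module. -/
lemma kills_ker_iff [SMulCommClass A K V] [Module.Finite K V]
    (hK : ∀ φ : V →ₗ[A] V, ∃ c : K, ∀ v, φ v = c • v) (a x : A) :
    (∀ v : V, a • v = 0 → x • v = 0) ↔ ∃ y z : A, (∀ v : V, z • v = 0) ∧ x = y * a + z := by
  constructor
  · intro h
    obtain ⟨Y, hY⟩ := exists_comp_eq_of_ker_le (K := K) (φ := DistribSMul.toLinearMap K V a)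
      (ψ := DistribSMul.toLinearMap K V x) fun v hv => h v hv
    obtain ⟨y, hy⟩ := exists_smul_eq_linearMap hK Y
    refine ⟨y, x - y * a, fun v => ?_, by abel⟩
    rw [sub_smul, mul_smul, hy]
    exact sub_eq_zero.mpr (hY v).symm
  · rintro ⟨y, z, hz, rfl⟩ v hv
    rw [add_smul, mul_smul, hv, hz, smul_zero, add_zero]

end Density

open SkewPolynomial

/-! ### Left ideals of `D[t;σ]` -/

section LeftIdeals

variable {D : Type*} [DivisionRing D]

lemma natDeg_eq_of_deg_eq {p : SkewPolynomial D} {m : ℕ} (h : deg p = m) : natDeg p = m := by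
  simp [natDeg, h]

lemma natDeg_lt_iff {p : SkewPolynomial D} (hp : p ≠ 0) {m : ℕ} :
    natDeg p < m ↔ ∀ i, m ≤ i → p.coeff i = 0 := by
  rw [← deg_lt_iff, deg_eq_natDeg hp]
  exact_mod_cast Iff.rfl

lemma natDeg_eq_of_coeff {p : SkewPolynomial D} {m : ℕ} (h1 : p.coeff m ≠ 0)
    (h2 : ∀ i, m < i → p.coeff i = 0) : natDeg p = m := by
  have hp : p ≠ 0 := by
    rintro rfl
    exact h1 (coeff_zero m)
  refine le_antisymm (Nat.lt_succ_iff.mp ((natDeg_lt_iff hp).mpr fun i hi => h2 i hi)) ?_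
  by_contra hc
  exact h1 (coeff_eq_zero_of_natDeg_lt (not_le.mp hc))

lemma coeff_finset_sum {ι : Type*} (s : Finset ι) (g : ι → SkewPolynomial D) (j : ℕ) :
    (∑ i ∈ s, g i).coeff j = ∑ i ∈ s, (g i).coeff j := by
  classical
  induction s using Finset.induction_on with
  | empty => simp
  | insert a s ha ih => rw [Finset.sum_insert ha, Finset.sum_insert ha, coeff_add, ih]

variable [MulSemiringAction (Multiplicative ℕ) D]

lemma coeff_C_mul (a : D) (p : SkewPolynomial D) (i : ℕ) :
    (C a * p).coeff i = a * p.coeff i := by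
  rw [← monomial_zero_left, coeff_monomial_mul]
  simp

lemma coeff_X_mul (p : SkewPolynomial D) (i : ℕ) :
    (X * p).coeff i = if 1 ≤ i then φ (p.coeff (i - 1)) else 0 := by
  rw [← monomial_one_one_eq_X, coeff_monomial_mul]
  simp

lemma coeff_mul_C (a : D) (p : SkewPolynomial D) (i : ℕ) :
    (p * C a).coeff i = p.coeff i * φ^[i] a := by
  induction p using SkewPolynomial.induction with
  | h0 => simp
  | ha n r q _ _ hq =>
    rw [add_mul, coeff_add, hq, monomial_mul_C, coeff_monomial, coeff_add, coeff_monomial]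
    by_cases h : n = i
    · subst h
      simp [add_mul]
    · simp [h]

lemma coeff_mul_X (p : SkewPolynomial D) (i : ℕ) :
    (p * X).coeff i = if 1 ≤ i then p.coeff (i - 1) else 0 := by
  induction p using SkewPolynomial.induction with
  | h0 => simp
  | ha n r q _ _ hq =>
    rw [add_mul, coeff_add, hq, monomial_mul_X, coeff_monomial, coeff_add, coeff_monomial]
    by_cases h : n + 1 = i
    · subst h
      simp
    · by_cases h1 : 1 ≤ i
      · simp [h, h1, show ¬ n = i - 1 by omega]
      · simp [h, h1]

lemma isUnit_C {a : D} (ha : a ≠ 0) : IsUnit (C a : SkewPolynomial D) :=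
  (isUnit_iff_ne_zero.mpr ha).map (CRingHom (R := D))

lemma span_singleton_C_mul {a : D} (ha : a ≠ 0) (p : SkewPolynomial D) :
    Ideal.span {C a * p} = Ideal.span {p} := by
  obtain ⟨v, hv⟩ := isUnit_C ha
  refine le_antisymm ?_ ?_
  · rw [Ideal.span_singleton_le_iff_mem]
    exact Ideal.mem_span_singleton'.mpr ⟨_, rfl⟩
  · rw [Ideal.span_singleton_le_iff_mem]
    refine Ideal.mem_span_singleton'.mpr ⟨↑v⁻¹, ?_⟩
    rw [← hv, ← mul_assoc, Units.inv_mul, one_mul]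

lemma natDeg_C_mul {a : D} (ha : a ≠ 0) (p : SkewPolynomial D) :
    natDeg (C a * p) = natDeg p := by
  by_cases hp : p = 0
  · simp [hp]
  · refine natDeg_eq_of_coeff ?_ fun i hi => ?_
    · rw [coeff_C_mul]
      exact mul_ne_zero ha (coeff_natDeg_ne_zero hp)
    · rw [coeff_C_mul, coeff_eq_zero_of_natDeg_lt hi, mul_zero]

/-- A nonzero skew polynomial is associated to a monic one. -/
lemma exists_monic_associate {p : SkewPolynomial D} (hp : p ≠ 0) :
    ∃ g, IsMonic g ∧ natDeg g = natDeg p ∧ Ideal.span {g} = Ideal.span {p} ∧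
      ∃ a : D, a ≠ 0 ∧ g = C a * p := by
  have ha : (p.coeff (natDeg p))⁻¹ ≠ 0 := inv_ne_zero (coeff_natDeg_ne_zero hp)
  refine ⟨C (p.coeff (natDeg p))⁻¹ * p, ?_, natDeg_C_mul ha p, span_singleton_C_mul ha p, _, ha, rfl⟩
  rw [IsMonic, natDeg_C_mul ha, coeff_C_mul, inv_mul_cancel₀ (coeff_natDeg_ne_zero hp)]

/-- Every nonzero left ideal of `D[t;σ]` has a monic generator. -/
lemma exists_monic_generator {I : Ideal (SkewPolynomial D)} (hI : I ≠ ⊥) :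
    ∃ g, IsMonic g ∧ I = Ideal.span {g} := by
  classical
  -- A nonzero element of least degree generates, by division with remainder. Zero has to be
  -- excluded explicitly because `natDeg 0 = 0`.
  have hex : ∃ N : ℕ, ∃ p ∈ I, p ≠ 0 ∧ natDeg p = N := by
    obtain ⟨p, hp, hp0⟩ := Submodule.exists_mem_ne_zero_of_ne_bot hI
    exact ⟨_, p, hp, hp0, rfl⟩
  obtain ⟨p, hp, hp0, hN⟩ := Nat.find_spec hex
  obtain ⟨g, hg, hdeg, hspan, -⟩ := exists_monic_associate hp0
  refine ⟨g, hg, le_antisymm (fun x hx => ?_) ?_⟩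
  · obtain ⟨r, hr, hm⟩ := exists_rem hg x
    have hgI : Ideal.span {g} ≤ I := by
      rw [hspan, Ideal.span_singleton_le_iff_mem]
      exact hp
    have hrI : r ∈ I := by
      have h := sub_mem hx (hgI hm)
      rwa [sub_sub_cancel] at h
    by_cases hr0 : r = 0
    · rwa [hr0, sub_zero] at hm
    · rw [deg_eq_natDeg hr0, deg_eq_natDeg hg.ne_zero, hdeg, hN] at hr
      exact absurd ⟨r, hrI, hr0, rfl⟩ (Nat.find_min hex (by exact_mod_cast hr))
  · rw [hspan, Ideal.span_singleton_le_iff_mem]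
    exact hp

lemma rightDvd_iff_mem {g a : SkewPolynomial D} : RightDvd g a ↔ a ∈ Ideal.span {g} := by
  rw [Ideal.mem_span_singleton', RightDvd]
  exact exists_congr fun q => eq_comm

lemma isGCRD_of_span_eq {g a b : SkewPolynomial D} (h : Ideal.span {g} = Ideal.span {a, b}) :
    IsGCRD g a b := by
  refine ⟨?_, ?_, fun e ha hb => ?_⟩
  · rw [rightDvd_iff_mem, h]
    exact Ideal.subset_span (by simp)
  · rw [rightDvd_iff_mem, h]
    exact Ideal.subset_span (by simp)
  · rw [rightDvd_iff_mem] at *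
    have h1 : Ideal.span {a, b} ≤ Ideal.span {e} := by
      rw [Ideal.span_le]
      rintro x (rfl | rfl)
      · exact ha
      · exact hb
    exact h1 (h ▸ Ideal.subset_span (by simp))

lemma exists_isGCRD (a b : SkewPolynomial D) : ∃ g, IsGCRD g a b := by
  by_cases h : Ideal.span {a, b} = ⊥
  · exact ⟨0, isGCRD_of_span_eq (by rw [h]; simp)⟩
  · obtain ⟨g, -, hg⟩ := exists_monic_generator h
    exact ⟨g, isGCRD_of_span_eq hg.symm⟩

/-- Bézout for an arbitrary, not normalised, greatest common right divisor: some generator g' of the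
left ideal exists and is a common right divisor, hence right-divides g, while g right-divides a and
b. -/
lemma IsGCRD.span_eq {g a b : SkewPolynomial D} (h : IsGCRD g a b) :
    Ideal.span {g} = Ideal.span {a, b} := by
  have hex : ∃ g', Ideal.span {g'} = Ideal.span {a, b} := by
    by_cases h : Ideal.span {a, b} = ⊥
    · exact ⟨0, by rw [h]; simp⟩
    · obtain ⟨g', -, hg'⟩ := exists_monic_generator h
      exact ⟨g', hg'.symm⟩
  obtain ⟨g', hg'⟩ := hex
  obtain ⟨h1, h2, -⟩ := isGCRD_of_span_eq hg'
  refine le_antisymm ?_ ?_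
  · rw [← hg', Ideal.span_singleton_le_iff_mem, ← rightDvd_iff_mem]
    exact h.2.2 g' h1 h2
  · rw [Ideal.span_le]
    rintro x (rfl | rfl)
    · exact rightDvd_iff_mem.mp h.1
    · exact rightDvd_iff_mem.mp h.2.1

/-- The left `D`-module `R/Rg` has a basis of monomials when `g` is monic. -/
lemma nonempty_equiv_quotient {g : SkewPolynomial D} (hg : IsMonic g) :
    Nonempty ((Fin (natDeg g) → D) ≃ₗ[D] (SkewPolynomial D ⧸ Ideal.span {g})) := by
  let T : (Fin (natDeg g) → D) →ₗ[D] SkewPolynomial D :=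
    ∑ i : Fin (natDeg g), (monomial (i : ℕ)).comp (LinearMap.proj i)
  have hT : ∀ c j, (T c).coeff j = if h : j < natDeg g then c ⟨j, h⟩ else 0 := by
    intro c j
    have h1 : T c = ∑ i : Fin (natDeg g), monomial (i : ℕ) (c i) := by simp [T]
    rw [h1, coeff_finset_sum]
    simp only [coeff_monomial]
    split_ifs with h
    · rw [Finset.sum_eq_single ⟨j, h⟩]
      · simp
      · intro i _ hi
        rw [if_neg fun h' => hi (Fin.ext h')]
      · simp
    · refine Finset.sum_eq_zero fun i _ => if_neg ?_
      have := i.2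
      omega
  have hdeg : ∀ c, deg (T c) < deg g := by
    intro c
    rw [deg_eq_natDeg hg.ne_zero, deg_lt_iff]
    intro i hi
    rw [hT, dif_neg (by omega)]
  let π : SkewPolynomial D →ₗ[D] (SkewPolynomial D ⧸ Ideal.span {g}) :=
    (Submodule.mkQ (Ideal.span {g})).restrictScalars D
  refine ⟨LinearEquiv.ofBijective (π ∘ₗ T) ⟨?_, ?_⟩⟩
  · rw [injective_iff_map_eq_zero]
    intro c hc
    have h1 : T c ∈ Ideal.span {g} := (Submodule.Quotient.mk_eq_zero _).mp hc
    have h2 := eq_zero_of_deg_lt hg h1 (hdeg c)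
    ext i
    have h3 := hT c i
    rw [h2, dif_pos i.2] at h3
    exact h3.symm
  · intro y
    obtain ⟨p, rfl⟩ := Submodule.mkQ_surjective _ y
    obtain ⟨r, hr, hm⟩ := exists_rem hg p
    refine ⟨fun i => r.coeff i, ?_⟩
    have h1 : T (fun i : Fin (natDeg g) => r.coeff i) = r := by
      ext j
      rw [hT]
      split_ifs with h
      · rfl
      · rw [deg_eq_natDeg hg.ne_zero, deg_lt_iff] at hr
        exact (hr j (by omega)).symm
    rw [LinearMap.comp_apply, h1]
    exact ((Submodule.Quotient.eq _).mpr hm).symm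

/-- This turns degrees into D-dimensions, the quantity compared in all later counts. -/
lemma finrank_quotient {g : SkewPolynomial D} (hg : g ≠ 0) :
    Module.finrank D (SkewPolynomial D ⧸ Ideal.span {g}) = natDeg g := by
  obtain ⟨p, hp, hdeg, hspan, -⟩ := exists_monic_associate hg
  obtain ⟨e⟩ := nonempty_equiv_quotient hp
  rw [← hspan, ← e.finrank_eq, ← hdeg]
  simp

lemma finite_quotient {g : SkewPolynomial D} (hg : g ≠ 0) :
    Module.Finite D (SkewPolynomial D ⧸ Ideal.span {g}) := by
  obtain ⟨p, hp, hdeg, hspan, -⟩ := exists_monic_associate hg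
  obtain ⟨e⟩ := nonempty_equiv_quotient hp
  rw [← hspan]
  exact Module.Finite.equiv e

end LeftIdeals

/-! ### Central elements of the form `p(u⁻¹tⁿ)` -/

section Central

variable {D : Type*} [DivisionRing D]

lemma iterate_inv_eq {σ : D ≃+* D} {u : D} (hσu : σ u = u) (i : ℕ) : σ^[i] u⁻¹ = u⁻¹ :=
  Function.iterate_fixed (by rw [map_inv₀, hσu]) i

/-- With i = qn + r, the power σ^(nq) is conjugation by u^q, so σ^r is conjugation by v u^(-q).
Minimality of n forces r = 0. -/
lemma dvd_of_iterate_eq {σ : D ≃+* D} {n : ℕ} (hn : 0 < n) {u : D} (hu : u ≠ 0)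
    (hσn : ∀ z : D, σ^[n] z = u * z * u⁻¹)
    (hmin : ∀ j : ℕ, 0 < j → j < n → ¬ ∃ v : D, v ≠ 0 ∧ ∀ z : D, σ^[j] z = v * z * v⁻¹)
    {i : ℕ} {v : D} (hv : v ≠ 0) (hi : ∀ z : D, σ^[i] z = v * z * v⁻¹) : n ∣ i := by
  have hpow : ∀ q : ℕ, ∀ z : D, σ^[n * q] z = u ^ q * z * (u ^ q)⁻¹ := by
    intro q
    induction q with
    | zero => simp
    | succ q ih =>
      intro z
      rw [mul_add_one, Function.iterate_add_apply, hσn, ih, pow_succ, mul_inv_rev]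
      simp only [mul_assoc]
  by_contra hdvd
  have hr : 0 < i % n := Nat.pos_of_ne_zero fun h => hdvd (Nat.dvd_of_mod_eq_zero h)
  have huq : u ^ (i / n) ≠ 0 := pow_ne_zero _ hu
  refine hmin _ hr (Nat.mod_lt _ hn) ⟨v * (u ^ (i / n))⁻¹, mul_ne_zero hv (inv_ne_zero huq), ?_⟩
  intro z
  -- The argument is chosen so that σ^(nq) carries it to z.
  have h := hi ((u ^ (i / n))⁻¹ * z * u ^ (i / n))
  rw [← Nat.mod_add_div i n, Function.iterate_add_apply, hpow, Nat.mod_add_div] at h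
  have h1 : u ^ (i / n) * ((u ^ (i / n))⁻¹ * z * u ^ (i / n)) * (u ^ (i / n))⁻¹ = z := by
    rw [← mul_assoc, ← mul_assoc, mul_inv_cancel₀ huq, one_mul, mul_assoc,
      mul_inv_cancel₀ huq, mul_one]
  rw [h1] at h
  rw [h, mul_inv_rev, inv_inv]
  simp only [mul_assoc]

variable [MulSemiringAction (Multiplicative ℕ) D]

lemma phi_iterate_eq {σ : D ≃+* D}
    (hσ : ∀ z : D, (Multiplicative.ofAdd 1 : Multiplicative ℕ) • z = σ z) (i : ℕ) (z : D) :
    φ^[i] z = σ^[i] z := by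
  have h : (φ : D → D) = σ := funext hσ
  rw [h]

lemma C_mul_X_pow_pow {σ : D ≃+* D}
    (hσ : ∀ z : D, (Multiplicative.ofAdd 1 : Multiplicative ℕ) • z = σ z)
    {n : ℕ} {u : D} (hσu : σ u = u) (j : ℕ) :
    (C u⁻¹ * X ^ n : SkewPolynomial D) ^ j = monomial (n * j) (u⁻¹ ^ j) := by
  rw [C_mul_X_pow_eq_monomial]
  induction j with
  | zero => simp [C_1]
  | succ j ih =>
    rw [pow_succ, ih, monomial_mul_monomial, phi_iterate_eq hσ, iterate_inv_eq hσu, mul_add_one,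
      pow_succ]

lemma evalCentral_eq_sum (σ : D ≃+* D) (n : ℕ) (u : D) (p : Polynomial (fixedCenter σ)) :
    evalCentral σ n u p =
      ∑ j ∈ p.support, C ((p.coeff j : Subring.center D) : D) * (C u⁻¹ * X ^ n) ^ j := by
  rw [evalCentral, Polynomial.eval₂_eq_sum, Polynomial.sum_def]
  rfl

lemma coeff_evalCentral {σ : D ≃+* D}
    (hσ : ∀ z : D, (Multiplicative.ofAdd 1 : Multiplicative ℕ) • z = σ z)
    {n : ℕ} (hn : 0 < n) {u : D} (hσu : σ u = u) (p : Polynomial (fixedCenter σ)) (i : ℕ) :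
    (evalCentral σ n u p).coeff i =
      if n ∣ i then ((p.coeff (i / n) : Subring.center D) : D) * u⁻¹ ^ (i / n) else 0 := by
  rw [evalCentral_eq_sum, coeff_finset_sum]
  simp only [C_mul_X_pow_pow hσ hσu, coeff_C_mul, coeff_monomial]
  split_ifs with h
  · obtain ⟨l, rfl⟩ := h
    rw [Nat.mul_div_cancel_left _ hn, Finset.sum_eq_single l]
    · simp
    · intro j _ hj
      rw [if_neg fun h' => hj (Nat.eq_of_mul_eq_mul_left hn h'), mul_zero]
    · intro hl
      rw [Polynomial.notMem_support_iff.mp hl]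
      simp
  · refine Finset.sum_eq_zero fun j _ => ?_
    rw [if_neg fun h' => h ⟨j, h'.symm⟩, mul_zero]

lemma natDeg_evalCentral {σ : D ≃+* D}
    (hσ : ∀ z : D, (Multiplicative.ofAdd 1 : Multiplicative ℕ) • z = σ z)
    {n : ℕ} (hn : 0 < n) {u : D} (hu : u ≠ 0) (hσu : σ u = u) {p : Polynomial (fixedCenter σ)}
    (hp : p ≠ 0) : natDeg (evalCentral σ n u p) = n * p.natDegree := by
  refine natDeg_eq_of_coeff ?_ fun i hi => ?_
  · rw [coeff_evalCentral hσ hn hσu, if_pos (dvd_mul_right _ _), Nat.mul_div_cancel_left _ hn]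
    refine mul_ne_zero ?_ (pow_ne_zero _ (inv_ne_zero hu))
    have h := Polynomial.leadingCoeff_ne_zero.mpr hp
    simpa using h
  · rw [coeff_evalCentral hσ hn hσu]
    split_ifs with h
    · obtain ⟨l, rfl⟩ := h
      rw [Nat.mul_div_cancel_left _ hn,
        Polynomial.coeff_eq_zero_of_natDegree_lt (lt_of_mul_lt_mul_left hi n.zero_le)]
      simp
    · rfl

lemma evalCentral_ne_zero {σ : D ≃+* D}
    (hσ : ∀ z : D, (Multiplicative.ofAdd 1 : Multiplicative ℕ) • z = σ z)
    {n : ℕ} (hn : 0 < n) {u : D} (hu : u ≠ 0) (hσu : σ u = u) {p : Polynomial (fixedCenter σ)}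
    (hp : p ≠ 0) : evalCentral σ n u p ≠ 0 := by
  intro h0
  have h := coeff_evalCentral hσ hn hσu p (n * p.natDegree)
  rw [h0, if_pos (dvd_mul_right _ _), Nat.mul_div_cancel_left _ hn, coeff_zero] at h
  have h1 := Polynomial.leadingCoeff_ne_zero.mpr hp
  exact mul_ne_zero (by simpa using h1) (pow_ne_zero _ (inv_ne_zero hu)) h.symm

lemma mem_center_of_commute {x : SkewPolynomial D} (hC : ∀ a : D, C a * x = x * C a)
    (hX : X * x = x * X) : x ∈ Subring.center (SkewPolynomial D) := by
  rw [Subring.mem_center_iff]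
  intro p
  induction p using SkewPolynomial.induction with
  | h0 => simp
  | ha n r q _ _ hq =>
    have h : Commute (C r * X ^ n) x := Commute.mul_left (hC r) (Commute.pow_left hX n)
    rw [add_mul, mul_add, hq, ← C_mul_X_pow_eq_monomial, h.eq]

lemma C_mem_center {σ : D ≃+* D}
    (hσ : ∀ z : D, (Multiplicative.ofAdd 1 : Multiplicative ℕ) • z = σ z) (c : fixedCenter σ) :
    C ((c : Subring.center D) : D) ∈ Subring.center (SkewPolynomial D) := by
  refine mem_center_of_commute (fun a => ?_) ?_
  · rw [← C_mul, ← C_mul, Subring.mem_center_iff.mp (c : Subring.center D).2 a]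
  · have h : σ ((c : Subring.center D) : D) = (c : Subring.center D) := c.2
    ext i
    rw [coeff_X_mul, coeff_C_mul, coeff_X]
    by_cases hi : i = 1
    · subst hi
      simpa using (hσ _).trans h
    · rw [if_neg (Ne.symm hi), mul_zero]
      split_ifs with h1
      · rw [coeff_C_ne_zero (by omega), map_zero]
      · rfl

/-- The factor u⁻¹ cancels the conjugation in tⁿa = u a u⁻¹ tⁿ, and t commutes with u⁻¹ because σ
fixes u. -/
lemma C_mul_X_pow_mem_center {σ : D ≃+* D}
    (hσ : ∀ z : D, (Multiplicative.ofAdd 1 : Multiplicative ℕ) • z = σ z)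
    {n : ℕ} {u : D} (hu : u ≠ 0) (hσu : σ u = u) (hσn : ∀ z : D, σ^[n] z = u * z * u⁻¹) :
    C u⁻¹ * X ^ n ∈ Subring.center (SkewPolynomial D) := by
  rw [C_mul_X_pow_eq_monomial]
  refine mem_center_of_commute (fun a => ?_) ?_
  · rw [C_mul_monomial, monomial_mul_C, phi_iterate_eq hσ, hσn, ← mul_assoc, ← mul_assoc,
      inv_mul_cancel₀ hu, one_mul]
  · rw [X_mul_monomial, monomial_mul_X]
    have h : φ u⁻¹ = u⁻¹ := (hσ _).trans (iterate_inv_eq hσu 1)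
    rw [h]

lemma evalCentral_mem_center {σ : D ≃+* D}
    (hσ : ∀ z : D, (Multiplicative.ofAdd 1 : Multiplicative ℕ) • z = σ z)
    {n : ℕ} {u : D} (hu : u ≠ 0) (hσu : σ u = u) (hσn : ∀ z : D, σ^[n] z = u * z * u⁻¹)
    (p : Polynomial (fixedCenter σ)) :
    evalCentral σ n u p ∈ Subring.center (SkewPolynomial D) := by
  rw [evalCentral_eq_sum]
  exact sum_mem fun j _ => mul_mem (C_mem_center hσ _)
    (pow_mem (C_mul_X_pow_mem_center hσ hu hσu hσn) j)

/-- Evaluation at `u⁻¹tⁿ` as a ring homomorphism to the center of `D[t;σ]`. -/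
def evalCentralHom {σ : D ≃+* D}
    (hσ : ∀ z : D, (Multiplicative.ofAdd 1 : Multiplicative ℕ) • z = σ z)
    {n : ℕ} {u : D} (hu : u ≠ 0) (hσu : σ u = u) (hσn : ∀ z : D, σ^[n] z = u * z * u⁻¹) :
    Polynomial (fixedCenter σ) →+* Subring.center (SkewPolynomial D) :=
  (Polynomial.eval₂RingHom'
      ((CRingHom.comp (Subring.center D).subtype).comp (fixedCenter σ).subtype)
      (C u⁻¹ * X ^ n)
      fun c => (Subring.mem_center_iff.mp (C_mem_center hσ c) (C u⁻¹ * X ^ n)).symm).codRestrict _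
    (evalCentral_mem_center hσ hu hσu hσn)

lemma coe_evalCentralHom {σ : D ≃+* D}
    (hσ : ∀ z : D, (Multiplicative.ofAdd 1 : Multiplicative ℕ) • z = σ z)
    {n : ℕ} {u : D} (hu : u ≠ 0) (hσu : σ u = u) (hσn : ∀ z : D, σ^[n] z = u * z * u⁻¹)
    (p : Polynomial (fixedCenter σ)) :
    (evalCentralHom hσ hu hσu hσn p : SkewPolynomial D) = evalCentral σ n u p := rfl

/-- A monic generator of a two-sided ideal with nonzero constant term is, up to a constant,
of the form `p(u⁻¹tⁿ)`. -/
lemma exists_evalCentral_of_two_sided {σ : D ≃+* D}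
    (hσ : ∀ z : D, (Multiplicative.ofAdd 1 : Multiplicative ℕ) • z = σ z)
    {n : ℕ} (hn : 0 < n) {u : D} (hu : u ≠ 0) (hσu : σ u = u)
    (hσn : ∀ z : D, σ^[n] z = u * z * u⁻¹)
    (hmin : ∀ j : ℕ, 0 < j → j < n → ¬ ∃ v : D, v ≠ 0 ∧ ∀ z : D, σ^[j] z = v * z * v⁻¹)
    {g : SkewPolynomial D} (hg : IsMonic g) (hg0 : g.coeff 0 ≠ 0)
    (htwo : ∀ p, g * p ∈ Ideal.span {g}) :
    ∃ p : Polynomial (fixedCenter σ), p ≠ 0 ∧ evalCentral σ n u p = C (g.coeff 0)⁻¹ * g := by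
  have hgN : g.coeff (natDeg g) = 1 := hg
  have hgself : ∀ a : SkewPolynomial D, a * g ∈ Ideal.span {g} := fun a =>
    Ideal.mem_span_singleton'.mpr ⟨a, rfl⟩
  -- Let N = deg g. In ga − σ^N(a)g the leading terms cancel, and the difference lies in Rg, so it
  -- vanishes; the claim is its coefficient of t^i.
  have hcomm : ∀ a i, g.coeff i * σ^[i] a = σ^[natDeg g] a * g.coeff i := by
    intro a i
    have h := eq_zero_of_deg_lt hg (sub_mem (htwo (C a)) (hgself (C (σ^[natDeg g] a)))) (by
      rw [deg_eq_natDeg hg.ne_zero, deg_lt_iff]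
      intro i hi
      rw [coeff_sub, coeff_mul_C, coeff_C_mul, phi_iterate_eq hσ]
      rcases Nat.eq_or_lt_of_le hi with rfl | h
      · rw [hgN]
        simp
      · rw [coeff_eq_zero_of_natDeg_lt h]
        simp)
    have h1 := congrArg (fun p => coeff p i) h
    simp only [coeff_sub, coeff_mul_C, coeff_C_mul, phi_iterate_eq hσ, coeff_zero] at h1
    exact sub_eq_zero.mp h1
  -- Let w = gt − tg. Its coefficient at N + 1 is 1 − σ(1) = 0, so w minus (coefficient of w at N)
  -- times g has degree below N and lies in Rg, hence is zero. Since w has no constant term and g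
  -- does, that coefficient is zero, so w = 0.
  have hfix : ∀ i, σ (g.coeff i) = g.coeff i := by
    set w := g * X - X * g with hw
    have hwi : ∀ i, w.coeff (i + 1) = g.coeff i - σ (g.coeff i) := by
      intro i
      rw [hw, coeff_sub, coeff_mul_X, coeff_X_mul]
      simp [← hσ]
    have hw0 : w.coeff 0 = 0 := by
      rw [hw, coeff_sub, coeff_mul_X, coeff_X_mul]
      simp
    have h := eq_zero_of_deg_lt hg
      (sub_mem (sub_mem (htwo X) (hgself X)) (hgself (C (w.coeff (natDeg g))))) (by
        rw [deg_eq_natDeg hg.ne_zero, deg_lt_iff, ← hw]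
        intro i hi
        rw [coeff_sub, coeff_C_mul]
        rcases Nat.eq_or_lt_of_le hi with rfl | h
        · rw [hgN]
          simp
        · obtain ⟨j, rfl⟩ : ∃ j, i = j + 1 := ⟨i - 1, by omega⟩
          rw [coeff_eq_zero_of_natDeg_lt h, hwi]
          rcases Nat.eq_or_lt_of_le (Nat.lt_succ_iff.mp h) with rfl | h'
          · rw [hgN]
            simp
          · rw [coeff_eq_zero_of_natDeg_lt h']
            simp)
    rw [← hw] at h
    have hb : w.coeff (natDeg g) = 0 := by
      have h1 := congrArg (fun p => coeff p 0) h
      simp only [coeff_sub, coeff_C_mul, coeff_zero, hw0, zero_sub, neg_eq_zero] at h1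
      exact (mul_eq_zero.mp h1).resolve_right hg0
    rw [hb, C_0, zero_mul, sub_zero] at h
    intro i
    have h1 := hwi i
    rw [h, coeff_zero] at h1
    exact (sub_eq_zero.mp h1.symm).symm
  -- By the relation for the constant term, dividing by it removes the twist σ^N: now e_i σ^i(a) = a
  -- e_i. A nonzero e_i thus makes σ^i inner, which forces n ∣ i.
  set e : ℕ → D := fun i => (g.coeff 0)⁻¹ * g.coeff i with he
  have hefix : ∀ i, σ (e i) = e i := fun i => by
    simp only [he, map_mul, map_inv₀, hfix]
  have hecomm : ∀ a i, e i * σ^[i] a = a * e i := by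
    intro a i
    have h0 : g.coeff 0 * a = σ^[natDeg g] a * g.coeff 0 := hcomm a 0
    simp only [he]
    rw [mul_assoc, hcomm, (eq_mul_inv_iff_mul_eq₀ hg0).mpr h0.symm, ← mul_assoc, ← mul_assoc,
      ← mul_assoc, inv_mul_cancel₀ hg0, one_mul, mul_assoc]
  have hedvd : ∀ i, e i ≠ 0 → n ∣ i := fun i hi => by
    refine dvd_of_iterate_eq hn hu hσn hmin (inv_ne_zero hi) fun z => ?_
    rw [inv_inv, mul_assoc, ← hecomm, ← mul_assoc, inv_mul_cancel₀ hi, one_mul]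
  -- These are the coefficients to be found: e_(nj) t^(nj) equals (e_(nj) u^j)(u⁻¹tⁿ)^j, and u^j
  -- absorbs the conjugation σ^(nj).
  have hcenter : ∀ j, e (n * j) * u ^ j ∈ Subring.center D := by
    intro j
    rw [Subring.mem_center_iff]
    intro a
    have hj : ∀ j : ℕ, ∀ z : D, σ^[n * j] z * u ^ j = u ^ j * z := by
      intro j
      induction j with
      | zero => simp
      | succ j ih =>
        intro z
        rw [mul_add_one, Function.iterate_add_apply, pow_succ, ← mul_assoc, ih, hσn]
        simp only [mul_assoc]
        rw [inv_mul_cancel₀ hu, mul_one]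
    rw [← mul_assoc, ← hecomm a (n * j), mul_assoc (e (n * j)), hj, ← mul_assoc]
  let z : ℕ → fixedCenter σ := fun j => ⟨⟨e (n * j) * u ^ j, hcenter j⟩, by
    change σ (e (n * j) * u ^ j) = e (n * j) * u ^ j
    rw [map_mul, map_pow, hefix, hσu]⟩
  let p : Polynomial (fixedCenter σ) :=
    ∑ j ∈ Finset.range (natDeg g + 1), Polynomial.monomial j (z j)
  have hp : ∀ j, p.coeff j = z j := by
    intro j
    simp only [p, Polynomial.finsetSum_coeff, Polynomial.coeff_monomial, Finset.sum_ite_eq',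
      Finset.mem_range]
    split_ifs with h
    · rfl
    · refine Subtype.ext (Subtype.ext ?_)
      have h2 : natDeg g < n * j := lt_of_lt_of_le (by omega) (Nat.le_mul_of_pos_left j hn)
      change (0 : D) = (g.coeff 0)⁻¹ * g.coeff (n * j) * u ^ j
      rw [coeff_eq_zero_of_natDeg_lt h2]
      simp
  have hz : ∀ j, ((z j : Subring.center D) : D) = e (n * j) * u ^ j := fun j => rfl
  refine ⟨p, ?_, ?_⟩
  · intro h0
    have h1 := hp 0
    rw [h0, Polynomial.coeff_zero] at h1
    have h2 := congrArg (fun c : fixedCenter σ => ((c : Subring.center D) : D)) h1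
    simp [hz, he, hg0] at h2
  · ext i
    rw [coeff_evalCentral hσ hn hσu, coeff_C_mul]
    split_ifs with h
    · obtain ⟨j, rfl⟩ := h
      rw [Nat.mul_div_cancel_left _ hn, hp, hz, inv_pow, mul_inv_cancel_right₀ (pow_ne_zero _ hu)]
    · by_contra hne
      exact h (hedvd i (Ne.symm hne))

end Central

/-! ### The simple module `V_f` and its endomorphisms -/

section SimpleModule

variable {D : Type*} [DivisionRing D] [MulSemiringAction (Multiplicative ℕ) D]

namespace PetitAlgebra

instance (f : SkewPolynomial D) (hf : IsMonic f) : Module D (PetitAlgebra f hf) :=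
  inferInstanceAs (Module D (SkewPolynomial D ⧸ Ideal.span {f}))

instance (f : SkewPolynomial D) (hf : IsMonic f) :
    IsScalarTower D (SkewPolynomial D) (PetitAlgebra f hf) :=
  inferInstanceAs (IsScalarTower D (SkewPolynomial D) (SkewPolynomial D ⧸ Ideal.span {f}))

instance (f : SkewPolynomial D) (hf : IsMonic f) : Module.Finite D (PetitAlgebra f hf) :=
  finite_quotient hf.ne_zero

lemma finrank_eq (f : SkewPolynomial D) (hf : IsMonic f) :
    Module.finrank D (PetitAlgebra f hf) = natDeg f :=
  finrank_quotient hf.ne_zero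

lemma C_smul (f : SkewPolynomial D) (hf : IsMonic f) (c : D) (v : PetitAlgebra f hf) :
    (C c : SkewPolynomial D) • v = c • v := by
  have h : (C c : SkewPolynomial D) = c • (1 : SkewPolynomial D) := by
    rw [← monomial_zero_one, smul_monomial, smul_eq_mul, mul_one, monomial_zero_left]
  rw [h, smul_assoc, one_smul]

lemma smul_mk_one (f : SkewPolynomial D) (hf : IsMonic f) (a : SkewPolynomial D) :
    a • mk f hf 1 = mk f hf a := by
  rw [← map_smul, smul_eq_mul, mul_one]

lemma mk_one_ne_zero {f : SkewPolynomial D} (hf : IsMonic f) (hm : 0 < natDeg f) :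
    mk f hf 1 ≠ 0 := by
  intro h
  rw [mk_eq_zero] at h
  have h1 := eq_zero_of_deg_lt hf h (by
    rw [deg_eq_natDeg hf.ne_zero, deg_lt_iff]
    intro i hi
    rw [coeff_one, if_neg (by omega)])
  exact one_ne_zero h1

/-- A left ideal strictly above Rf is some Rg with f = qg. If q is a unit then Rg = Rf, a
contradiction; otherwise g is a unit and Rg = R. -/
lemma isSimpleModule {f : SkewPolynomial D} (hf : IsMonic f) (hm : 0 < natDeg f)
    (hirr : Irreducible f) : IsSimpleModule (SkewPolynomial D) (PetitAlgebra f hf) := by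
  refine isSimpleModule_iff_isCoatom.mpr (⟨?_, fun I hI => ?_⟩ : IsCoatom (Ideal.span {f}))
  · intro h
    exact mk_one_ne_zero hf hm ((mk_eq_zero f hf).mpr (h ▸ Submodule.mem_top))
  · have hne : I ≠ ⊥ := (bot_le.trans_lt hI).ne'
    obtain ⟨g, -, rfl⟩ := exists_monic_generator hne
    obtain ⟨q, hq⟩ := Ideal.mem_span_singleton'.mp (hI.le (Ideal.mem_span_singleton_self f))
    rcases hirr.isUnit_or_isUnit hq.symm with h | h
    · obtain ⟨v, rfl⟩ := h
      refine absurd ?_ hI.not_ge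
      rw [Ideal.span_singleton_le_iff_mem]
      exact Ideal.mem_span_singleton'.mpr ⟨↑v⁻¹, by rw [← hq, ← mul_assoc, Units.inv_mul, one_mul]⟩
    · exact Ideal.eq_top_of_isUnit_mem _ (Ideal.mem_span_singleton_self g) h

variable {f : SkewPolynomial D} {hf : IsMonic f}

lemma mk_mul_of_deg_lt {a : SkewPolynomial D} (ha : deg a < deg f) (y : PetitAlgebra f hf) :
    mk f hf a * y = a • y := by
  rw [mul_eq_smul, rep_unique f hf ha rfl]

lemma smul_mul_nucleus_of_deg_lt (z : NucR f hf) {a : SkewPolynomial D} (ha : deg a < deg f)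
    (y : PetitAlgebra f hf) : (a • y) * (z : PetitAlgebra f hf) = a • (y * z) := by
  rw [← mk_mul_of_deg_lt ha, ← mk_mul_of_deg_lt ha]
  exact z.2 _ _

/-- Right multiplication by an element of the right nucleus is left `R`-linear. -/
lemma smul_mul_nucleus (hm : 1 < natDeg f) (z : NucR f hf) (a : SkewPolynomial D)
    (y : PetitAlgebra f hf) : (a • y) * (z : PetitAlgebra f hf) = a • (y * z) := by
  have hC : ∀ (c : D) (y : PetitAlgebra f hf),
      ((C c : SkewPolynomial D) • y) * (z : PetitAlgebra f hf) = (C c : SkewPolynomial D) • (y * z) :=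
    fun c => smul_mul_nucleus_of_deg_lt z (by
      rw [deg_eq_natDeg hf.ne_zero, deg_lt_iff]
      intro i hi
      rw [coeff_C_ne_zero (by omega)])
  -- Powers of t may have degree at least m, so the nucleus identity is applied to one factor t at a
  -- time; t is its own representative because m > 1.
  have hX : ∀ (n : ℕ) (y : PetitAlgebra f hf),
      ((X ^ n : SkewPolynomial D) • y) * (z : PetitAlgebra f hf) =
        (X ^ n : SkewPolynomial D) • (y * z) := by
    intro n
    induction n with
    | zero => simp
    | succ n ih =>
      intro y
      rw [pow_succ, mul_smul, ih, mul_smul, smul_mul_nucleus_of_deg_lt z]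
      rw [deg_eq_natDeg hf.ne_zero, deg_lt_iff]
      intro i hi
      rw [coeff_X_of_ne_one (by omega)]
  induction a using SkewPolynomial.induction with
  | h0 => simp
  | ha n r q _ _ hq =>
    rw [add_smul, add_mul, hq, ← C_mul_X_pow_eq_monomial, mul_smul, hC, hX, ← mul_smul, ← add_smul]

lemma op_smul_def (z : (NucR f hf)ᵐᵒᵖ) (y : PetitAlgebra f hf) :
    z • y = y * (z.unop : PetitAlgebra f hf) := rfl

lemma smulCommClass (hm : 1 < natDeg f) :
    SMulCommClass (SkewPolynomial D) (NucR f hf)ᵐᵒᵖ (PetitAlgebra f hf) :=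
  ⟨fun a z y => (smul_mul_nucleus hm z.unop a y).symm⟩

instance : FaithfulSMul (NucR f hf)ᵐᵒᵖ (PetitAlgebra f hf) :=
  ⟨fun {z w} h => by
    have h1 := h 1
    rw [op_smul_def, op_smul_def, one_mul, one_mul] at h1
    exact MulOpposite.unop_injective (Subtype.ext h1)⟩

/-- Every endomorphism of `R/Rf` is right multiplication by an element of the right nucleus. -/
lemma exists_nucleus_of_linearMap
    (ψ : PetitAlgebra f hf →ₗ[SkewPolynomial D] PetitAlgebra f hf) :
    ∃ z : (NucR f hf)ᵐᵒᵖ, ∀ v, ψ v = z • v := by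
  -- An endomorphism is determined by the image of 1, since v = `rep v` • 1.
  have h : ∀ v, ψ v = v * ψ 1 := by
    intro v
    rw [mul_eq_smul, ← map_smul, one_def, smul_mk_one, mk_rep]
  refine ⟨MulOpposite.op ⟨ψ 1, fun x y => ?_⟩, h⟩
  rw [← h, ← h, mul_eq_smul, map_smul, mul_eq_smul]

/-- Because tR ⊆ Rt, the kernel of t is a submodule of the simple module V_f. If it were everything,
t would lie in Rf, which is impossible for m > 1. -/
lemma X_smul_injective (hm : 1 < natDeg f) (hirr : Irreducible f)
    (v : PetitAlgebra f hf) (hv : (X : SkewPolynomial D) • v = 0) : v = 0 := by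
  have := isSimpleModule hf (by omega) hirr
  let N : Submodule (SkewPolynomial D) (PetitAlgebra f hf) :=
    { carrier := {v | (X : SkewPolynomial D) • v = 0}
      add_mem' := fun {a b} ha hb => by
        rw [Set.mem_ofPred_eq] at *
        rw [smul_add, ha, hb, add_zero]
      zero_mem' := smul_zero _
      smul_mem' := fun c x hx => by
        rw [Set.mem_ofPred_eq] at *
        rw [← mul_smul, X_mul, mul_smul, hx, smul_zero] }
  rcases eq_bot_or_eq_top N with h | h
  · have h1 : v ∈ N := hv
    rwa [h, Submodule.mem_bot] at h1
  · have h1 : mk f hf 1 ∈ N := h ▸ Submodule.mem_top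
    have h2 : (X : SkewPolynomial D) • mk f hf 1 = 0 := h1
    rw [smul_mk_one, mk_eq_zero] at h2
    refine absurd (eq_zero_of_deg_lt hf h2 ?_) X_ne_zero
    rw [deg_eq_natDeg hf.ne_zero, deg_lt_iff]
    intro i hi
    rw [coeff_X_of_ne_one (by omega)]

lemma center_smul (c : Subring.center (SkewPolynomial D)) (a : SkewPolynomial D) :
    (c : SkewPolynomial D) • mk f hf a = a • mk f hf c := by
  rw [← map_smul, smul_eq_mul, ← Subring.mem_center_iff.mp c.2 a, ← smul_eq_mul, map_smul]

/-- A central element annihilates `R/Rf` iff it is a left multiple of `f`. -/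
lemma center_smul_eq_zero_iff (c : Subring.center (SkewPolynomial D)) :
    (∀ v : PetitAlgebra f hf, (c : SkewPolynomial D) • v = 0) ↔
      RightDvd f (c : SkewPolynomial D) := by
  rw [rightDvd_iff_mem, ← mk_eq_zero f hf]
  constructor
  · intro h
    rw [← smul_mk_one]
    exact h _
  · intro h v
    obtain ⟨a, rfl⟩ := mk_surjective f hf v
    rw [center_smul, h, smul_zero]

/-- The annihilator of `R/Rf` is generated by the minimal central left multiple of `f`. -/
lemma smul_eq_zero_iff_mem_span (hm : 1 < natDeg f) (hirr : Irreducible f) {σ : D ≃+* D}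
    (hσ : ∀ z : D, (Multiplicative.ofAdd 1 : Multiplicative ℕ) • z = σ z)
    {n : ℕ} (hn : 0 < n) {u : D} (hu : u ≠ 0) (hσu : σ u = u)
    (hσn : ∀ z : D, σ^[n] z = u * z * u⁻¹)
    (hmin : ∀ j : ℕ, 0 < j → j < n → ¬ ∃ v : D, v ≠ 0 ∧ ∀ z : D, σ^[j] z = v * z * v⁻¹)
    {h : Subring.center (SkewPolynomial D)} {hhat : Polynomial (fixedCenter σ)}
    (hh : IsMclm σ n u f h hhat) (a : SkewPolynomial D) :
    (∀ v : PetitAlgebra f hf, a • v = 0) ↔ a ∈ Ideal.span {(h : SkewPolynomial D)} := by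
  let I : Ideal (SkewPolynomial D) :=
    { carrier := {a | ∀ v : PetitAlgebra f hf, a • v = 0}
      add_mem' := fun {a b} ha hb v => by rw [add_smul, ha v, hb v, add_zero]
      zero_mem' := fun v => zero_smul _ v
      smul_mem' := fun c x hx v => by rw [smul_eq_mul, mul_smul, hx v, smul_zero] }
  have hI : ∀ a, a ∈ I ↔ ∀ v : PetitAlgebra f hf, a • v = 0 := fun a => Iff.rfl
  have hh0 : (h : SkewPolynomial D) ≠ 0 := by
    rw [hh.eq_eval]
    exact evalCentral_ne_zero hσ hn hu hσu hh.monic.ne_zero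
  have hhI : (h : SkewPolynomial D) ∈ I := (center_smul_eq_zero_iff h).mpr hh.rightDvd
  obtain ⟨g, hg, hIg⟩ := exists_monic_generator (Submodule.ne_bot_iff _ |>.mpr ⟨_, hhI, hh0⟩)
  have hgI : g ∈ I := hIg ▸ Ideal.mem_span_singleton_self g
  -- Otherwise g = tg', where the coefficients of g' are those of g shifted and moved by σ⁻¹. As t
  -- acts injectively, g' also annihilates V_f, yet it has smaller degree than the generator g.
  have hg0 : g.coeff 0 ≠ 0 := by
    intro h0
    let g' : SkewPolynomial D :=
      ∑ i ∈ Finset.range (natDeg g), monomial i (σ.symm (g.coeff (i + 1)))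
    have hg'c : ∀ j, g'.coeff j = if j < natDeg g then σ.symm (g.coeff (j + 1)) else 0 := by
      intro j
      simp only [g', coeff_finset_sum, coeff_monomial, Finset.sum_ite_eq', Finset.mem_range]
    have hgg' : g = X * g' := by
      ext i
      rw [coeff_X_mul]
      split_ifs with hi
      · obtain ⟨j, rfl⟩ : ∃ j, i = j + 1 := ⟨i - 1, by omega⟩
        rw [Nat.add_sub_cancel, hg'c]
        split_ifs with hj
        · exact ((hσ _).trans (σ.apply_symm_apply _)).symm
        · rw [coeff_eq_zero_of_natDeg_lt (by omega), map_zero]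
      · rw [show i = 0 by omega, h0]
    have hg'I : g' ∈ I := fun v => X_smul_injective hm hirr _ (by
      rw [← mul_smul, ← hgg', hgI v])
    rw [hIg] at hg'I
    have hz := eq_zero_of_deg_lt hg hg'I (by
      rw [deg_eq_natDeg hg.ne_zero, deg_lt_iff]
      intro i hi
      rw [hg'c, if_neg (by omega)])
    rw [hz, mul_zero] at hgg'
    exact hg.ne_zero hgg'
  -- The annihilator is two-sided, so g is up to a constant a polynomial in u⁻¹tⁿ. Made monic in x,
  -- this polynomial competes with ĥ in the minimality of h, giving deg h ≤ deg g.
  obtain ⟨p, hp, hpg⟩ := exists_evalCentral_of_two_sided hσ hn hu hσu hσn hmin hg hg0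
    fun b => hIg ▸ fun v => by rw [mul_smul, hgI]
  set q : Polynomial (fixedCenter σ) := Polynomial.C p.leadingCoeff⁻¹ * p with hq
  have hlead : p.leadingCoeff⁻¹ ≠ 0 := inv_ne_zero (Polynomial.leadingCoeff_ne_zero.mpr hp)
  have hqmonic : q.Monic := by
    rw [hq, Polynomial.Monic, Polynomial.leadingCoeff_mul, Polynomial.leadingCoeff_C,
      inv_mul_cancel₀ (Polynomial.leadingCoeff_ne_zero.mpr hp)]
  have hqI : evalCentral σ n u q ∈ I := by
    rw [← coe_evalCentralHom hσ hu hσu hσn, hq, map_mul, Subring.coe_mul, coe_evalCentralHom,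
      coe_evalCentralHom, hpg]
    exact Ideal.mul_mem_left _ _ (Ideal.mul_mem_left _ _ hgI)
  have hle := hh.minimal (evalCentralHom hσ hu hσu hσn q) q hqmonic rfl
    ((center_smul_eq_zero_iff _).mp hqI)
  have hdegq : natDeg (evalCentral σ n u q) = natDeg g := by
    rw [natDeg_evalCentral hσ hn hu hσu hqmonic.ne_zero, hq, Polynomial.natDegree_C_mul hlead,
      ← natDeg_evalCentral hσ hn hu hσu hp, hpg, natDeg_C_mul (inv_ne_zero hg0)]
  rw [coe_evalCentralHom, deg_eq_natDeg hh0,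
    deg_eq_natDeg (evalCentral_ne_zero hσ hn hu hσu hqmonic.ne_zero), hdegq] at hle
  have hle' : natDeg (h : SkewPolynomial D) ≤ natDeg g := by exact_mod_cast hle
  -- h lies in Rg and has degree at most deg g, so it is a constant multiple of g.
  have hhg : (h : SkewPolynomial D) = C ((h : SkewPolynomial D).coeff (natDeg g)) * g := by
    refine sub_eq_zero.mp (eq_zero_of_deg_lt hg
      (sub_mem (hIg ▸ hhI) (Ideal.mem_span_singleton'.mpr ⟨_, rfl⟩)) ?_)
    rw [deg_eq_natDeg hg.ne_zero, deg_lt_iff]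
    intro i hi
    rw [coeff_sub, coeff_C_mul]
    rcases Nat.eq_or_lt_of_le hi with rfl | hlt
    · rw [show g.coeff (natDeg g) = 1 from hg, mul_one, sub_self]
    · rw [coeff_eq_zero_of_natDeg_lt hlt, coeff_eq_zero_of_natDeg_lt (hle'.trans_lt hlt), mul_zero,
        sub_zero]
  have hb : (h : SkewPolynomial D).coeff (natDeg g) ≠ 0 := by
    intro hb
    rw [hb, C_0, zero_mul] at hhg
    exact hh0 hhg
  rw [← hI, hIg, hhg, span_singleton_C_mul hb]

end PetitAlgebra

/-! ### Dimension counts -/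

section Count

variable {K : Type*} [DivisionRing K] {f : SkewPolynomial D} {hf : IsMonic f}
  [Module K (PetitAlgebra f hf)]

/-- By density a ↦ (a w_i) maps R onto V_f^s, and it factors through R/Rg; the bound compares
D-dimensions. No finiteness of V_f over `K` is assumed, so the bound can be used to prove it. -/
lemma mul_natDeg_le_of_linearIndependent [IsSimpleModule (SkewPolynomial D) (PetitAlgebra f hf)]
    (hK : ∀ φ : PetitAlgebra f hf →ₗ[SkewPolynomial D] PetitAlgebra f hf, ∃ c : K, ∀ v, φ v = c • v)
    {g : SkewPolynomial D} (hg : g ≠ 0) {s : ℕ} {w : Fin s → PetitAlgebra f hf}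
    (hw : LinearIndependent K w) (hgw : ∀ i, g • w i = 0) :
    s * natDeg f ≤ natDeg g := by
  let T : SkewPolynomial D →ₗ[SkewPolynomial D] (Fin s → PetitAlgebra f hf) :=
    LinearMap.toSpanSingleton _ _ w
  have hle : Ideal.span {g} ≤ LinearMap.ker T := by
    rw [Ideal.span_singleton_le_iff_mem]
    exact funext hgw
  let T' : (SkewPolynomial D ⧸ Ideal.span {g}) →ₗ[SkewPolynomial D] (Fin s → PetitAlgebra f hf) :=
    Submodule.liftQ _ T hle
  have hsurj : Function.Surjective (T'.restrictScalars D) := by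
    intro t
    obtain ⟨a, ha⟩ := exists_smul_eq_of_linearIndependent hK hw t
    exact ⟨Submodule.Quotient.mk a, funext ha⟩
  have := finite_quotient hg
  have h := LinearMap.finrank_le_finrank_of_surjective hsurj
  rw [finrank_quotient hg, Module.finrank_pi_fintype] at h
  simpa [PetitAlgebra.finrank_eq] using h

lemma mul_natDeg_eq_of_linearIndependent [IsSimpleModule (SkewPolynomial D) (PetitAlgebra f hf)]
    (hK : ∀ φ : PetitAlgebra f hf →ₗ[SkewPolynomial D] PetitAlgebra f hf, ∃ c : K, ∀ v, φ v = c • v)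
    {g : SkewPolynomial D} (hg : g ≠ 0) {s : ℕ} {w : Fin s → PetitAlgebra f hf}
    (hw : LinearIndependent K w) (hgw : ∀ a, a ∈ Ideal.span {g} ↔ ∀ i, a • w i = 0) :
    s * natDeg f = natDeg g := by
  let T : SkewPolynomial D →ₗ[SkewPolynomial D] (Fin s → PetitAlgebra f hf) :=
    LinearMap.toSpanSingleton _ _ w
  have hker : LinearMap.ker T = Ideal.span {g} := by
    ext a
    rw [hgw]
    exact funext_iff
  have hsurj : Function.Surjective T := fun t => by
    obtain ⟨a, ha⟩ := exists_smul_eq_of_linearIndependent hK hw t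
    exact ⟨a, funext ha⟩
  have h := ((T.quotKerEquivOfSurjective hsurj).restrictScalars D).finrank_eq
  rw [hker, finrank_quotient hg, Module.finrank_pi_fintype] at h
  simpa [PetitAlgebra.finrank_eq] using h.symm

variable [SMulCommClass (SkewPolynomial D) K (PetitAlgebra f hf)]
  [IsSimpleModule (SkewPolynomial D) (PetitAlgebra f hf)]

lemma finite_and_finrank_mul
    (hK : ∀ φ : PetitAlgebra f hf →ₗ[SkewPolynomial D] PetitAlgebra f hf, ∃ c : K, ∀ v, φ v = c • v)
    (hm : 0 < natDeg f) {h : SkewPolynomial D} (hh0 : h ≠ 0)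
    (hann : ∀ a, (∀ v : PetitAlgebra f hf, a • v = 0) ↔ a ∈ Ideal.span {h}) :
    Module.Finite K (PetitAlgebra f hf) ∧
      Module.finrank K (PetitAlgebra f hf) * natDeg f = natDeg h := by
  have hh := (hann h).mpr (Ideal.mem_span_singleton_self h)
  have hfin : Module.Finite K (PetitAlgebra f hf) := by
    by_contra hinf
    -- Any deg h + 1 independent vectors, all killed by h, would give (deg h + 1)m ≤ deg h.
    have hrank : ((natDeg h + 1 : ℕ) : Cardinal) ≤ Module.rank K (PetitAlgebra f hf) := by
      rw [← Module.rank_lt_aleph0_iff, not_lt] at hinf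
      exact (Cardinal.natCast_lt_aleph0).le.trans hinf
    obtain ⟨s, hs, hli⟩ := exists_finset_linearIndependent_of_le_rank hrank
    have h1 := mul_natDeg_le_of_linearIndependent hK hh0
      (hli.comp _ (s.equivFin).symm.injective) fun i => hh _
    rw [hs] at h1
    nlinarith
  refine ⟨hfin, ?_⟩
  let b := Module.finBasis K (PetitAlgebra f hf)
  refine mul_natDeg_eq_of_linearIndependent hK hh0 b.linearIndependent fun a => ?_
  rw [← hann]
  refine ⟨fun ha i => ha _, fun ha v => ?_⟩
  have h0 : DistribSMul.toLinearMap K (PetitAlgebra f hf) a = 0 := b.ext ha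
  exact DFunLike.congr_fun h0 v

/-- The elements killing ker a form Ra + Rh = Rg, so a basis of ker a satisfies dim(ker a) · m = deg
g. Rank-nullity then converts this into the dimension of the image. -/
lemma finrank_range_smul
    (hK : ∀ φ : PetitAlgebra f hf →ₗ[SkewPolynomial D] PetitAlgebra f hf, ∃ c : K, ∀ v, φ v = c • v)
    (hm : 0 < natDeg f) {h : SkewPolynomial D} (hh0 : h ≠ 0)
    (hann : ∀ a, (∀ v : PetitAlgebra f hf, a • v = 0) ↔ a ∈ Ideal.span {h})
    {a g : SkewPolynomial D} (hg : IsGCRD g a h) :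
    Module.finrank K (LinearMap.range (DistribSMul.toLinearMap K (PetitAlgebra f hf) a)) *
      natDeg f + natDeg g = natDeg h := by
  obtain ⟨hfin, hdim⟩ := finite_and_finrank_mul hK hm hh0 hann
  set L := DistribSMul.toLinearMap K (PetitAlgebra f hf) a with hL
  have hg0 : g ≠ 0 := by
    rintro rfl
    obtain ⟨q, hq⟩ := hg.2.1
    exact hh0 (by rw [hq, mul_zero])
  let b := Module.finBasis K (LinearMap.ker L)
  have hw : LinearIndependent K fun i => (b i : PetitAlgebra f hf) :=
    b.linearIndependent.map' (LinearMap.ker L).subtype (Submodule.ker_subtype _)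
  have hcount := mul_natDeg_eq_of_linearIndependent hK hg0 hw fun x => by
    have h1 : (∀ i, x • (b i : PetitAlgebra f hf) = 0) ↔
        ∀ v : PetitAlgebra f hf, a • v = 0 → x • v = 0 := by
      constructor
      · intro hx v hv
        have h0 : DistribSMul.toLinearMap K (PetitAlgebra f hf) x ∘ₗ (LinearMap.ker L).subtype = 0 :=
          b.ext hx
        exact DFunLike.congr_fun h0 (⟨v, hv⟩ : LinearMap.ker L)
      · exact fun hx i => hx _ (b i).2
    rw [h1, kills_ker_iff hK, hg.span_eq, Ideal.mem_span_pair]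
    constructor
    · rintro ⟨y, z, hyz⟩
      exact ⟨y, z * h, (hann _).mpr (Ideal.mem_span_singleton'.mpr ⟨z, rfl⟩), hyz.symm⟩
    · rintro ⟨y, z, hz, rfl⟩
      obtain ⟨q, rfl⟩ := Ideal.mem_span_singleton'.mp ((hann z).mp hz)
      exact ⟨y, q, rfl⟩
  rw [← hcount, ← hdim, ← L.finrank_range_add_finrank_ker, add_mul]

end Count

end SimpleModule

open MulOpposite

/-! ### Matrices of endomorphisms of a right module -/

section Matrices

variable {B V : Type*} [Ring B] [AddCommGroup V] [Module Bᵐᵒᵖ V] {k : ℕ}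
  (e : Module.Basis (Fin k) Bᵐᵒᵖ V)

/-- Coordinates of `v` in a right basis, as a column vector over `B`. -/
def coordEquiv : V ≃ₗ[Bᵐᵒᵖ] (Fin k → B) where
  toFun v i := (e.repr v i).unop
  map_add' v w := by
    ext i
    simp
  map_smul' c v := by
    ext i
    simp
  invFun x := e.equivFun.symm fun i => op (x i)
  left_inv v := e.equivFun.symm_apply_apply v
  right_inv x := by
    ext i
    have h := congrFun (e.equivFun.apply_symm_apply fun i => op (x i)) i
    exact congrArg unop h

lemma coordEquiv_apply (v : V) (i : Fin k) : coordEquiv e v i = (e.repr v i).unop := rfl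

lemma sum_op_coordEquiv_smul (v : V) : ∑ i, op (coordEquiv e v i) • e i = v :=
  e.sum_repr v

/-- The matrix of a right linear endomorphism with respect to a right basis. -/
def endMatrix (T : V →ₗ[Bᵐᵒᵖ] V) : Matrix (Fin k) (Fin k) B :=
  Matrix.of fun i j => coordEquiv e (T (e j)) i

/-- Scalars act on the right and matrices on the left, so the usual coordinate formula survives
without commutativity of `B`. -/
lemma endMatrix_mulVec (T : V →ₗ[Bᵐᵒᵖ] V) (v : V) :
    (endMatrix e T).mulVec (coordEquiv e v) = coordEquiv e (T v) := by
  conv_rhs => rw [← sum_op_coordEquiv_smul e v]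
  rw [map_sum, map_sum]
  ext i
  simp only [map_smul, Finset.sum_apply, Pi.smul_apply, op_smul_eq_mul]
  rfl

lemma endMatrix_injective : Function.Injective (endMatrix (B := B) (V := V) e) := by
  intro S T h
  refine e.ext fun j => (coordEquiv e).injective (funext fun i => ?_)
  exact congrFun (congrFun h i) j

lemma endMatrix_comp (S T : V →ₗ[Bᵐᵒᵖ] V) :
    endMatrix e (S ∘ₗ T) = endMatrix e S * endMatrix e T := by
  ext i j
  have h := congrFun (endMatrix_mulVec e S (T (e j))) i
  exact h.symm

lemma endMatrix_id : endMatrix e LinearMap.id = 1 := by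
  ext i j
  simp only [endMatrix, Matrix.of_apply, coordEquiv_apply, LinearMap.id_apply,
    Module.Basis.repr_self, Matrix.one_apply, Finsupp.single_apply]
  by_cases h : i = j
  · simp [h]
  · simp [h, Ne.symm h]

lemma endMatrix_add (S T : V →ₗ[Bᵐᵒᵖ] V) :
    endMatrix e (S + T) = endMatrix e S + endMatrix e T := by
  ext i j
  simp [endMatrix]

lemma endMatrix_surjective : Function.Surjective (endMatrix (B := B) (V := V) e) := by
  intro M
  refine ⟨e.constr ℕ fun j => (coordEquiv e).symm fun i => M i j, ?_⟩
  ext i j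
  simp [endMatrix]

lemma range_eq_span (T : V →ₗ[Bᵐᵒᵖ] V) :
    LinearMap.range T = Submodule.span Bᵐᵒᵖ (Set.range fun j => T (e j)) := by
  rw [LinearMap.range_eq_map, ← e.span_eq, Submodule.map_span, ← Set.range_comp]
  rfl

/-- The column space of the matrix of `T` is the image of `T`. -/
lemma colRank_endMatrix (T : V →ₗ[Bᵐᵒᵖ] V) :
    colRank (endMatrix e T) = Module.finrank Bᵐᵒᵖ (LinearMap.range T) := by
  have h : Submodule.span Bᵐᵒᵖ (Set.range (endMatrix e T).col) =
      (LinearMap.range T).map (coordEquiv e).toLinearMap := by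
    rw [range_eq_span e, Submodule.map_span, ← Set.range_comp]
    rfl
  rw [colRank, h]
  exact ((coordEquiv e).submoduleMap (LinearMap.range T)).finrank_eq.symm

/-- Left multiplication by a matrix acts on each column separately, so its image consists of the
matrices whose k columns are all coordinate vectors of elements of im T. -/
lemma nonempty_range_mulLeftMap_equiv (T : V →ₗ[Bᵐᵒᵖ] V) :
    Nonempty (LinearMap.range (mulLeftMap (endMatrix e T)) ≃ₗ[Bᵐᵒᵖ]
      (Fin k → LinearMap.range T)) := by
  let G : (Fin k → LinearMap.range T) →ₗ[Bᵐᵒᵖ] Matrix (Fin k) (Fin k) B :=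
    { toFun := fun x => Matrix.of fun i j => coordEquiv e (x j) i
      map_add' := fun x y => by
        ext i j
        simp
      map_smul' := fun c x => by
        ext i j
        simp }
  have hG : Function.Injective G := by
    intro x y hxy
    refine funext fun j => Subtype.ext ((coordEquiv e).injective (funext fun i => ?_))
    exact congrFun (congrFun hxy i) j
  have hrange : LinearMap.range G = LinearMap.range (mulLeftMap (endMatrix e T)) := by
    ext M
    constructor
    · rintro ⟨x, rfl⟩
      choose y hy using fun j => (x j).2
      refine ⟨Matrix.of fun i j => coordEquiv e (y j) i, ?_⟩
      ext i j
      refine (congrFun (endMatrix_mulVec e T (y j)) i).trans ?_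
      rw [hy]
      rfl
    · rintro ⟨X, rfl⟩
      refine ⟨fun j => ⟨T ((coordEquiv e).symm fun i => X i j), _, rfl⟩, ?_⟩
      ext i j
      refine (congrFun (endMatrix_mulVec e T _) i).symm.trans ?_
      rw [LinearEquiv.apply_symm_apply]
      rfl
  exact ⟨((LinearEquiv.ofInjective G hG).trans (LinearEquiv.ofEq _ _ hrange)).symm⟩

lemma finrank_range_mulLeftMap (hB : ∀ c : Bᵐᵒᵖ, IsUnit c ∨ c = 0) [Nontrivial B]
    (T : V →ₗ[Bᵐᵒᵖ] V) :
    Module.finrank Bᵐᵒᵖ (LinearMap.range (mulLeftMap (endMatrix e T))) =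
      k * Module.finrank Bᵐᵒᵖ (LinearMap.range T) := by
  let _ : DivisionRing Bᵐᵒᵖ := DivisionRing.ofIsUnitOrEqZero hB
  have : Module.Finite Bᵐᵒᵖ V := Module.Finite.of_basis e
  obtain ⟨E⟩ := nonempty_range_mulLeftMap_equiv e T
  have h1 := E.finrank_eq
  have h2 := Module.finrank_pi_fintype Bᵐᵒᵖ (M := fun _ : Fin k => LinearMap.range T)
  rw [Finset.sum_const, Finset.card_univ, Fintype.card_fin, smul_eq_mul] at h2
  exact h1.trans h2

/-- The column rank agrees with the usual rank after an isomorphism to a commutative ring. -/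
lemma rank_map_eq_colRank {A : Type*} [CommRing A] (ε : B ≃+* A)
    (M : Matrix (Fin k) (Fin k) B) : (M.map ε).rank = colRank M := by
  -- In the commutative ring `A` right coefficients may be written on the left, so the two column
  -- spaces correspond entrywise under ε.
  have hmem : ∀ x : Fin k → B, x ∈ Submodule.span Bᵐᵒᵖ (Set.range M.col) ↔
      (fun i => ε (x i)) ∈ Submodule.span A (Set.range (M.map ε).col) := by
    intro x
    rw [Submodule.mem_span_range_iff_exists_fun, Submodule.mem_span_range_iff_exists_fun]
    constructor
    · rintro ⟨c, rfl⟩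
      refine ⟨fun j => ε (c j).unop, ?_⟩
      ext i
      simp [Finset.sum_apply, mul_comm]
    · rintro ⟨c, hc⟩
      refine ⟨fun j => op (ε.symm (c j)), ?_⟩
      ext i
      refine ε.injective ((Eq.trans ?_ (congrFun hc i)))
      simp [Finset.sum_apply, mul_comm]
  let j : Submodule.span Bᵐᵒᵖ (Set.range M.col) ≃+
      Submodule.span A (Set.range (M.map ε).col) :=
    { toFun := fun x => ⟨fun i => ε (x.1 i), (hmem x.1).mp x.2⟩
      invFun := fun y => ⟨fun i => ε.symm (y.1 i), (hmem _).mpr (by simp [y.2])⟩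
      left_inv := fun x => by simp
      right_inv := fun y => by simp
      map_add' := fun x y => by
        ext i
        simp }
  have h := lift_rank_eq_of_equiv_equiv (fun c : Bᵐᵒᵖ => ε c.unop) j
    (ε.bijective.comp MulOpposite.unop_bijective) fun c x => by
      ext i
      simp [j, mul_comm]
  rw [Matrix.rank_eq_finrank_span_cols, colRank, Module.finrank, Module.finrank,
    ← Cardinal.toNat_lift, ← h, Cardinal.toNat_lift]

end Matrices

/-! ### The degree of `D` over the fixed field `F` -/

section FixedField

variable {D : Type*} [DivisionRing D]

/-- Conjugation by u is trivial on C, so σ restricts to C with order at most n. F is the fixed field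
of the finite cyclic group it generates, and Artin's bound applies. -/
lemma finrank_fixedCenter_le {σ : D ≃+* D} {n : ℕ} (hn : 0 < n) {u : D}
    (hu : u ≠ 0) (hσn : ∀ z : D, σ^[n] z = u * z * u⁻¹) :
    Module.Finite (fixedCenter σ) (Subring.center D) ∧
      Module.finrank (fixedCenter σ) (Subring.center D) ≤ n := by
  let τ : RingAut (Subring.center D) := Subring.centerCongr σ
  have hτ : ∀ c : Subring.center D, ((τ c : Subring.center D) : D) = σ c := fun c => rfl
  have hpow : ∀ (j : ℕ) (c : Subring.center D), (((τ ^ j) c : Subring.center D) : D) = σ^[j] c := by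
    intro j
    induction j with
    | zero => simp
    | succ j ih =>
      intro c
      rw [pow_succ', Function.iterate_succ_apply', ← ih]
      rfl
  have hτn : τ ^ n = 1 := by
    ext c
    rw [hpow, hσn, Subring.mem_center_iff.mp c.2 u, mul_assoc, mul_inv_cancel₀ hu, mul_one]
    rfl
  let G := Subgroup.zpowers τ
  have hfinite : Finite G :=
    finite_zpowers.mpr (isOfFinOrder_iff_pow_eq_one.mpr ⟨n, hn, hτn⟩)
  have hcard : Nat.card G ≤ n := by
    rw [Nat.card_zpowers]
    exact orderOf_le_of_pow_eq_one hn hτn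
  have hF : FixedPoints.subfield G (Subring.center D) = fixedCenter σ := by
    ext c
    constructor
    · intro hc
      have h : τ c = c := hc ⟨τ, Subgroup.mem_zpowers τ⟩
      exact congrArg Subtype.val h
    · intro hc
      have h : τ ∈ MulAction.stabilizer (RingAut (Subring.center D)) c := Subtype.ext hc
      exact fun g => (Subgroup.zpowers_le.mpr h) g.2
  have := Fintype.ofFinite G
  rw [← hF]
  refine ⟨inferInstance, (FixedPoints.finrank_le_card G (Subring.center D)).trans ?_⟩
  rwa [← Nat.card_eq_fintype_card]

lemma finite_and_finrank_le {σ : D ≃+* D} {n : ℕ} (hn : 0 < n) {u : D}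
    (hu : u ≠ 0) (hσn : ∀ z : D, σ^[n] z = u * z * u⁻¹) {r : ℕ} (hr : 0 < r)
    (hD : Module.finrank (Subring.center D) D = r) :
    Module.Finite (fixedCenter σ) D ∧ Module.finrank (fixedCenter σ) D ≤ n * r := by
  obtain ⟨h1, h2⟩ := finrank_fixedCenter_le hn hu hσn
  have : Module.Finite (Subring.center D) D := Module.finite_of_finrank_pos (hD ▸ hr)
  refine ⟨Module.Finite.trans (Subring.center D) D, ?_⟩
  rw [← Module.finrank_mul_finrank (fixedCenter σ) (Subring.center D) D, hD]
  exact Nat.mul_le_mul_right r h2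

end FixedField

/-! ### A dimension count -/

section Surjective

/-- Computing dim_F V through D and through K gives [D:F] dim_D V = [K:F] k, so `hdim` says [K:F] ≤
[A:F], and an injective F-linear map A → K must be onto. Only an upper bound for [D:F] is needed. -/
lemma surjective_of_finrank_mul_le {F D K V A : Type*} [Field F] [DivisionRing D] [Module F D]
    [Module.Finite F D] [AddCommGroup V] [Module D V] [Module.Finite D V] [Module F V]
    [IsScalarTower F D V] [Ring K] [Nontrivial K] (hK : ∀ c : K, IsUnit c ∨ c = 0) [Module K V]
    {v : V} (hv : ∀ b c : K, b • v = c • v → b = c) {k : ℕ} (hk : 0 < k)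
    (e : Module.Basis (Fin k) K V) (ι : F →+* K) (hι : ∀ (c : F) (v : V), ι c • v = c • v)
    [AddCommGroup A] [Module F A] [Module.Finite F A] (T : A →+ K) (hT : Function.Injective T)
    (hTι : ∀ (c : F) (x : A), T (c • x) = ι c * T x)
    (hdim : Module.finrank F D * Module.finrank D V ≤ Module.finrank F A * k) :
    Function.Surjective T := by
  let _ : DivisionRing K := DivisionRing.ofIsUnitOrEqZero hK
  let _ : Module F K := Module.compHom K ι
  have hsmul : ∀ (c : F) (b : K), c • b = ι c * b := fun c b => rfl
  have htower : IsScalarTower F K V := ⟨fun c b v => by rw [hsmul, mul_smul, hι]⟩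
  have hfinV : Module.Finite F V := Module.Finite.trans D V
  -- b ↦ b • v embeds K in the finite-dimensional F-space V.
  have hfinK : Module.Finite F K := by
    let S : K →ₗ[F] V := (LinearMap.toSpanSingleton K V v).restrictScalars F
    exact Module.Finite.of_injective S fun b c hbc => hv b c hbc
  have hdimK : Module.finrank F K ≤ Module.finrank F A := by
    have h1 := Module.finrank_mul_finrank F D V
    have h2 := Module.finrank_mul_finrank F K V
    rw [Module.finrank_eq_card_basis e, Fintype.card_fin] at h2
    rw [h1, ← h2] at hdim
    exact Nat.le_of_mul_le_mul_right hdim hk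
  let T' : A →ₗ[F] K :=
    { toFun := T
      map_add' := map_add T
      map_smul' := hTι }
  exact (LinearMap.injective_iff_surjective_of_finrank_eq_finrank (f := T')
    (le_antisymm (LinearMap.finrank_le_finrank_of_injective (f := T') hT) hdimK)).mp hT

end Surjective

/-! ### Central elements in the right nucleus -/

section Nucleus

variable {D : Type*} [DivisionRing D] [MulSemiringAction (Multiplicative ℕ) D]

lemma PetitAlgebra.mul_mk_center {f : SkewPolynomial D} {hf : IsMonic f}
    (c : Subring.center (SkewPolynomial D)) (x : PetitAlgebra f hf) :
    x * PetitAlgebra.mk f hf c = (c : SkewPolynomial D) • x := by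
  rw [mul_eq_smul, ← center_smul, mk_rep]

/-- The class of a central element of `R` lies in the right nucleus of `S_f`. -/
def centerToNucleus (f : SkewPolynomial D) (hf : IsMonic f) :
    Subring.center (SkewPolynomial D) →+* NucR f hf where
  toFun c := ⟨PetitAlgebra.mk f hf c, fun x y => by
    rw [PetitAlgebra.mul_mk_center, PetitAlgebra.mul_mk_center, PetitAlgebra.mul_eq_smul,
      PetitAlgebra.mul_eq_smul, ← mul_smul, ← mul_smul, Subring.mem_center_iff.mp c.2]⟩
  map_one' := rfl
  map_mul' c c' := Subtype.ext (by
    change PetitAlgebra.mk f hf (c * c' : SkewPolynomial D) =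
      PetitAlgebra.mk f hf c * PetitAlgebra.mk f hf c'
    rw [PetitAlgebra.mul_mk_center, ← map_smul, smul_eq_mul, Subring.mem_center_iff.mp c'.2])
  map_zero' := Subtype.ext (map_zero _)
  map_add' c c' := Subtype.ext (map_add (PetitAlgebra.mk f hf) _ _)

variable {f : SkewPolynomial D} {hf : IsMonic f} {σ : D ≃+* D} {n : ℕ} {u : D}

/-- The class of `p(u⁻¹tⁿ)` in the right nucleus. -/
def evalNucleus (hf : IsMonic f)
    (hσ : ∀ z : D, (Multiplicative.ofAdd 1 : Multiplicative ℕ) • z = σ z)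
    (hu : u ≠ 0) (hσu : σ u = u) (hσn : ∀ z : D, σ^[n] z = u * z * u⁻¹) :
    Polynomial (fixedCenter σ) →+* NucR f hf :=
  (centerToNucleus f hf).comp (evalCentralHom hσ hu hσu hσn)

lemma coe_evalNucleus (hσ : ∀ z : D, (Multiplicative.ofAdd 1 : Multiplicative ℕ) • z = σ z)
    (hu : u ≠ 0) (hσu : σ u = u) (hσn : ∀ z : D, σ^[n] z = u * z * u⁻¹)
    (p : Polynomial (fixedCenter σ)) :
    (evalNucleus hf hσ hu hσu hσn p : PetitAlgebra f hf) =
      PetitAlgebra.mk f hf (evalCentral σ n u p) := rfl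

/-- If p is in the kernel, so is its remainder modulo ĥ. A nonzero remainder could be scaled to a
monic polynomial of smaller degree than ĥ, against the minimality of h. -/
lemma evalNucleus_eq_zero_iff
    (hσ : ∀ z : D, (Multiplicative.ofAdd 1 : Multiplicative ℕ) • z = σ z) (hn : 0 < n)
    (hu : u ≠ 0) (hσu : σ u = u) (hσn : ∀ z : D, σ^[n] z = u * z * u⁻¹)
    {h : Subring.center (SkewPolynomial D)} {hhat : Polynomial (fixedCenter σ)}
    (hh : IsMclm σ n u f h hhat) (p : Polynomial (fixedCenter σ)) :
    evalNucleus hf hσ hu hσu hσn p = 0 ↔ hhat ∣ p := by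
  have hiff : ∀ p, evalNucleus hf hσ hu hσu hσn p = 0 ↔ RightDvd f (evalCentral σ n u p) := by
    intro p
    rw [rightDvd_iff_mem, ← PetitAlgebra.mk_eq_zero f hf, ← coe_evalNucleus hσ hu hσu hσn]
    exact (ZeroMemClass.coe_eq_zero).symm
  have hhat0 : evalNucleus hf hσ hu hσu hσn hhat = 0 := by
    rw [hiff, ← hh.eq_eval]
    exact hh.rightDvd
  constructor
  · intro hp
    have hr : evalNucleus hf hσ hu hσu hσn (p %ₘ hhat) = 0 := by
      rw [← Polynomial.modByMonic_add_div p hhat, map_add, map_mul, hhat0, zero_mul, add_zero] at hp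
      exact hp
    rw [← Polynomial.modByMonic_eq_zero_iff_dvd hh.monic]
    by_contra hne
    set r := p %ₘ hhat with hrdef
    have hlead := Polynomial.leadingCoeff_ne_zero.mpr hne
    have hmonic : (Polynomial.C r.leadingCoeff⁻¹ * r).Monic := by
      rw [Polynomial.Monic, Polynomial.leadingCoeff_mul, Polynomial.leadingCoeff_C,
        inv_mul_cancel₀ hlead]
    have hle := hh.minimal (evalCentralHom hσ hu hσu hσn (Polynomial.C r.leadingCoeff⁻¹ * r)) _
      hmonic rfl ((hiff _).mp (by rw [map_mul, hr, mul_zero]))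
    rw [hh.eq_eval, coe_evalCentralHom,
      deg_eq_natDeg (evalCentral_ne_zero hσ hn hu hσu hh.monic.ne_zero),
      deg_eq_natDeg (evalCentral_ne_zero hσ hn hu hσu hmonic.ne_zero),
      natDeg_evalCentral hσ hn hu hσu hh.monic.ne_zero,
      natDeg_evalCentral hσ hn hu hσu hmonic.ne_zero,
      Polynomial.natDegree_C_mul (inv_ne_zero hlead)] at hle
    have hle' : n * hhat.natDegree ≤ n * r.natDegree := by exact_mod_cast hle
    have hlt : r.natDegree < hhat.natDegree :=
      Polynomial.natDegree_lt_natDegree hne (Polynomial.degree_modByMonic_lt p hh.monic)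
    exact absurd (Nat.le_of_mul_le_mul_left hle' hn) (not_le.mpr hlt)
  · rintro ⟨q, rfl⟩
    rw [map_mul, hhat0, zero_mul]

/-- If `V_f` has dimension `k` over `B` and `[D : F] m ≤ k deg ĥ`, then `F[x]/(ĥ) ≅ B`. -/
lemma exists_nucleus_equiv
    (hσ : ∀ z : D, (Multiplicative.ofAdd 1 : Multiplicative ℕ) • z = σ z) (hn : 0 < n)
    (hu : u ≠ 0) (hσu : σ u = u) (hσn : ∀ z : D, σ^[n] z = u * z * u⁻¹)
    {h : Subring.center (SkewPolynomial D)} {hhat : Polynomial (fixedCenter σ)}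
    (hh : IsMclm σ n u f h hhat) [Module.Finite (fixedCenter σ) D]
    (hm : 0 < natDeg f) (hB : ∀ c : (NucR f hf)ᵐᵒᵖ, IsUnit c ∨ c = 0)
    {k : ℕ} (hk : 0 < k) (e : Module.Basis (Fin k) (NucR f hf)ᵐᵒᵖ (PetitAlgebra f hf))
    (hdim : Module.finrank (fixedCenter σ) D * natDeg f ≤ hhat.natDegree * k) :
    ∃ ε : AdjoinRoot hhat ≃+* NucR f hf, ∀ p : Polynomial (fixedCenter σ),
      (ε (AdjoinRoot.mk hhat p) : PetitAlgebra f hf) =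
        PetitAlgebra.mk f hf (evalCentral σ n u p) := by
  have hv : PetitAlgebra.mk f hf 1 ≠ 0 := PetitAlgebra.mk_one_ne_zero hf hm
  have : Nontrivial (NucR f hf) := ⟨0, 1, fun h01 => hv (congrArg Subtype.val h01).symm⟩
  let E := evalNucleus hf hσ hu hσu hσn
  let ε₀ : AdjoinRoot hhat →+* NucR f hf := Ideal.Quotient.lift (Ideal.span {hhat}) E fun p hp =>
    (evalNucleus_eq_zero_iff hσ hn hu hσu hσn hh p).mpr (Ideal.mem_span_singleton.mp hp)
  have hε₀ : ∀ p, ε₀ (AdjoinRoot.mk hhat p) = E p := fun p => rfl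
  have hinj : Function.Injective ε₀ := by
    rw [injective_iff_map_eq_zero]
    intro x hx
    obtain ⟨p, rfl⟩ := AdjoinRoot.mk_surjective x
    rw [hε₀, evalNucleus_eq_zero_iff hσ hn hu hσu hσn hh] at hx
    exact AdjoinRoot.mk_eq_zero.mpr hx
  let ι : fixedCenter σ →+* (NucR f hf)ᵐᵒᵖ := (E.comp Polynomial.C).toOpposite fun a b => by
    rw [commute_iff_eq, ← map_mul, ← map_mul, mul_comm]
  have hι : ∀ c, ι c = op (E (Polynomial.C c)) := fun c => rfl
  -- Constants from F are central in R, so the F-structures on V_f coming from D on the left and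
  -- from B on the right coincide. This allows the two dimension counts to be compared.
  have hιv : ∀ (c : fixedCenter σ) (v : PetitAlgebra f hf), ι c • v = c • v := by
    intro c v
    rw [hι, PetitAlgebra.op_smul_def, unop_op, coe_evalNucleus,
      ← coe_evalCentralHom hσ hu hσu hσn, PetitAlgebra.mul_mk_center, coe_evalCentralHom,
      evalCentral, Polynomial.eval₂_C]
    exact PetitAlgebra.C_smul f hf _ v
  have hfinA : Module.Finite (fixedCenter σ) (AdjoinRoot hhat) := hh.monic.finite_adjoinRoot
  have hdimA : Module.finrank (fixedCenter σ) (AdjoinRoot hhat) = hhat.natDegree := by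
    rw [(AdjoinRoot.powerBasis hh.monic.ne_zero).finrank, AdjoinRoot.powerBasis_dim]
  have hTsurj := surjective_of_finrank_mul_le (D := D) hB (v := (1 : PetitAlgebra f hf))
    (fun b c hbc => by
      rw [PetitAlgebra.op_smul_def, PetitAlgebra.op_smul_def, one_mul, one_mul] at hbc
      exact unop_injective (Subtype.ext hbc))
    hk e ι hιv ((opAddEquiv (α := NucR f hf)).toAddMonoidHom.comp ε₀.toAddMonoidHom)
    (fun x y hxy => hinj (op_injective hxy))
    (fun c x => by
      obtain ⟨p, rfl⟩ := AdjoinRoot.mk_surjective x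
      rw [AdjoinRoot.smul_mk, Polynomial.smul_eq_C_mul, mul_comm]
      exact congrArg op (map_mul E p (Polynomial.C c)))
    (by rwa [PetitAlgebra.finrank_eq, hdimA])
  have hsurj : Function.Surjective ε₀ := fun b => by
    obtain ⟨x, hx⟩ := hTsurj (op b)
    exact ⟨x, op_injective hx⟩
  exact ⟨RingEquiv.ofBijective ε₀ ⟨hinj, hsurj⟩, fun p => rfl⟩

end Nucleus

/-! ### The isomorphism of R/Rh with M_k(B) and the ranks of its elements -/

section MainPart

variable {D : Type*} [DivisionRing D] [MulSemiringAction (Multiplicative ℕ) D]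
  {f : SkewPolynomial D} {hf : IsMonic f}

lemma leftMulMatrix_eq_endMatrix [SMulCommClass (SkewPolynomial D) (NucR f hf)ᵐᵒᵖ (PetitAlgebra f hf)]
    {k : ℕ} (e : Module.Basis (Fin k) (NucR f hf)ᵐᵒᵖ (PetitAlgebra f hf)) (a : SkewPolynomial D) :
    leftMulMatrix e a =
      endMatrix e (DistribSMul.toLinearMap (NucR f hf)ᵐᵒᵖ (PetitAlgebra f hf) a) := rfl

/-- The action of `R` on `V_f` in coordinates, as a ring homomorphism. -/
def leftMulMatrixHom [SMulCommClass (SkewPolynomial D) (NucR f hf)ᵐᵒᵖ (PetitAlgebra f hf)]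
    {k : ℕ} (e : Module.Basis (Fin k) (NucR f hf)ᵐᵒᵖ (PetitAlgebra f hf)) :
    SkewPolynomial D →+* Matrix (Fin k) (Fin k) (NucR f hf) where
  toFun := leftMulMatrix e
  map_one' := by
    rw [leftMulMatrix_eq_endMatrix, ← endMatrix_id e]
    exact congrArg _ (LinearMap.ext fun v => one_smul _ v)
  map_mul' a b := by
    rw [leftMulMatrix_eq_endMatrix, leftMulMatrix_eq_endMatrix, leftMulMatrix_eq_endMatrix,
      ← endMatrix_comp]
    exact congrArg _ (LinearMap.ext fun v => mul_smul a b v)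
  map_zero' := by
    ext i j
    simp [leftMulMatrix]
  map_add' a b := by
    rw [leftMulMatrix_eq_endMatrix, leftMulMatrix_eq_endMatrix, leftMulMatrix_eq_endMatrix,
      ← endMatrix_add]
    exact congrArg _ (LinearMap.ext fun v => add_smul a b v)

lemma leftMulMatrixHom_apply
    [SMulCommClass (SkewPolynomial D) (NucR f hf)ᵐᵒᵖ (PetitAlgebra f hf)]
    {k : ℕ} (e : Module.Basis (Fin k) (NucR f hf)ᵐᵒᵖ (PetitAlgebra f hf)) (a : SkewPolynomial D) :
    leftMulMatrixHom e a =
      endMatrix e (DistribSMul.toLinearMap (NucR f hf)ᵐᵒᵖ (PetitAlgebra f hf) a) := rfl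

/-- The kernel of a ↦ M_a is the annihilator of V_f, which `hann` identifies with Rh; surjectivity
is `hsurj`, the finite-dimensional form of density. -/
lemma exists_quotient_equiv
    [SMulCommClass (SkewPolynomial D) (NucR f hf)ᵐᵒᵖ (PetitAlgebra f hf)]
    {h : Subring.center (SkewPolynomial D)}
    (hann : ∀ a : SkewPolynomial D,
      (∀ v : PetitAlgebra f hf, a • v = 0) ↔ a ∈ Ideal.span {(h : SkewPolynomial D)})
    {k : ℕ} (e : Module.Basis (Fin k) (NucR f hf)ᵐᵒᵖ (PetitAlgebra f hf))
    (hsurj : ∀ T : PetitAlgebra f hf →ₗ[(NucR f hf)ᵐᵒᵖ] PetitAlgebra f hf,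
      ∃ a : SkewPolynomial D, ∀ v, a • v = T v) :
    ∃ Ψ : (SkewPolynomial D ⧸ Ideal.span {(h : SkewPolynomial D)}) ≃+*
        Matrix (Fin k) (Fin k) (NucR f hf),
      ∀ a : SkewPolynomial D,
        Ψ (Ideal.Quotient.mk (Ideal.span {(h : SkewPolynomial D)}) a) = leftMulMatrix e a := by
  have hzero : ∀ a : SkewPolynomial D,
      a ∈ Ideal.span {(h : SkewPolynomial D)} ↔ leftMulMatrixHom e a = 0 := by
    intro a
    rw [← hann]
    constructor
    · intro ha
      ext i j
      change ((e.repr (a • e j) i).unop : PetitAlgebra f hf) = 0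
      rw [ha]
      simp
    · intro ha v
      have h1 : endMatrix e (DistribSMul.toLinearMap (NucR f hf)ᵐᵒᵖ (PetitAlgebra f hf) a) =
          endMatrix e (DistribSMul.toLinearMap (NucR f hf)ᵐᵒᵖ (PetitAlgebra f hf)
            (0 : SkewPolynomial D)) :=
        by
          rw [← leftMulMatrixHom_apply, ← leftMulMatrixHom_apply, ha, map_zero]
      exact (DFunLike.congr_fun (endMatrix_injective e h1) v).trans (zero_smul _ v)
  let Ψ := Ideal.Quotient.lift (Ideal.span {(h : SkewPolynomial D)}) (leftMulMatrixHom e)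
    fun a ha => (hzero a).mp ha
  refine ⟨RingEquiv.ofBijective Ψ ⟨?_, ?_⟩, fun a => rfl⟩
  · rw [injective_iff_map_eq_zero]
    intro x hx
    obtain ⟨a, rfl⟩ := Ideal.Quotient.mk_surjective x
    exact Ideal.Quotient.eq_zero_iff_mem.mpr ((hzero a).mpr hx)
  · intro M
    obtain ⟨T, rfl⟩ := endMatrix_surjective e M
    obtain ⟨a, ha⟩ := hsurj T
    refine ⟨Ideal.Quotient.mk _ a, ?_⟩
    change leftMulMatrixHom e a = _
    rw [leftMulMatrixHom_apply]
    exact congrArg (endMatrix e) (LinearMap.ext ha)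

/-- The structure of `V_f` over its endomorphisms, in terms of a generator `h` of the
annihilator. -/
lemma exists_basis_and_equiv_and_finrank (hm : 1 < natDeg f) (hirr : Irreducible f)
    (hB : ∀ c : (NucR f hf)ᵐᵒᵖ, IsUnit c ∨ c = 0)
    [SMulCommClass (SkewPolynomial D) (NucR f hf)ᵐᵒᵖ (PetitAlgebra f hf)]
    {h : Subring.center (SkewPolynomial D)} (hh0 : (h : SkewPolynomial D) ≠ 0)
    (hann : ∀ a : SkewPolynomial D,
      (∀ v : PetitAlgebra f hf, a • v = 0) ↔ a ∈ Ideal.span {(h : SkewPolynomial D)})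
    {k : ℕ} (hdegh : natDeg (h : SkewPolynomial D) = k * natDeg f) :
    Nonempty (Module.Basis (Fin k) (NucR f hf)ᵐᵒᵖ (PetitAlgebra f hf)) ∧
    ∀ e : Module.Basis (Fin k) (NucR f hf)ᵐᵒᵖ (PetitAlgebra f hf),
      (∃ Ψ : (SkewPolynomial D ⧸ Ideal.span {(h : SkewPolynomial D)}) ≃+*
            Matrix (Fin k) (Fin k) (NucR f hf),
          ∀ a : SkewPolynomial D,
            Ψ (Ideal.Quotient.mk (Ideal.span {(h : SkewPolynomial D)}) a) = leftMulMatrix e a) ∧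
      ∀ a g : SkewPolynomial D, IsGCRD g a (h : SkewPolynomial D) →
        Module.finrank (NucR f hf)ᵐᵒᵖ
            (LinearMap.range (mulLeftMap (leftMulMatrix e a))) =
          k * colRank (leftMulMatrix e a) ∧
        colRank (leftMulMatrix e a) * natDeg f + natDeg g = k * natDeg f := by
  have hv : PetitAlgebra.mk f hf 1 ≠ 0 := PetitAlgebra.mk_one_ne_zero hf (by omega)
  have : Nontrivial (NucR f hf) := ⟨0, 1, fun h01 => hv (congrArg Subtype.val h01).symm⟩
  have := PetitAlgebra.isSimpleModule hf (by omega) hirr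
  have hK := PetitAlgebra.exists_nucleus_of_linearMap (f := f) (hf := hf)
  let _ : DivisionRing (NucR f hf)ᵐᵒᵖ := DivisionRing.ofIsUnitOrEqZero hB
  obtain ⟨hfin, hdim⟩ := finite_and_finrank_mul hK (by omega) hh0 hann
  rw [hdegh] at hdim
  have hk := Nat.eq_of_mul_eq_mul_right (by omega) hdim
  have hsurj := exists_smul_eq_linearMap (A := SkewPolynomial D) hK
  refine ⟨⟨Module.finBasisOfFinrankEq _ _ hk⟩, fun e => ⟨?_, fun a g hg => ⟨?_, ?_⟩⟩⟩
  · exact exists_quotient_equiv hann e hsurj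
  · rw [leftMulMatrix_eq_endMatrix, colRank_endMatrix, finrank_range_mulLeftMap e hB]
  · rw [leftMulMatrix_eq_endMatrix, colRank_endMatrix, ← hdegh]
    exact finrank_range_smul hK (by omega) hh0 hann hg

end MainPart

end SkewRank

end

theorem mainTheorem4
    {D : Type*} [DivisionRing D] [MulSemiringAction (Multiplicative ℕ) D]
    -- `D` is a central division algebra of degree `d` over its center
    (d : ℕ) (hd : 0 < d) (hD : Module.finrank (Subring.center D) D = d ^ 2)
    -- `σ` is the automorphism of `D` that defines `R = D[t;σ] = SkewPolynomial D`
    (σ : D ≃+* D) (hσ : ∀ z : D, (Multiplicative.ofAdd 1 : Multiplicative ℕ) • z = σ z)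
    -- `σ` has finite order `n` modulo inner automorphisms, `σⁿ(z) = u z u⁻¹`, `u ∈ Fix(σ)`
    (n : ℕ) (hn : 0 < n) (u : D) (hu : u ≠ 0) (hσu : σ u = u)
    (hσn : ∀ z : D, σ^[n] z = u * z * u⁻¹)
    (hmin : ∀ j : ℕ, 0 < j → j < n → ¬ ∃ v : D, v ≠ 0 ∧ ∀ z : D, σ^[j] z = v * z * v⁻¹)
    -- `f` is monic and irreducible of degree `m > 1` with `(f,t)_r = 1`
    (f : SkewPolynomial D) (hf : SkewRank.IsMonic f) (hirr : Irreducible f)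
    (m : ℕ) (hm : 1 < m) (hdegf : SkewRank.deg f = (m : WithBot ℕ))
    (hft : SkewRank.IsGCRD 1 f SkewPolynomial.X)
    -- `h = ĥ(u⁻¹tⁿ)` is the minimal central left multiple of `f`, and `deg h = km`
    (h : Subring.center (SkewPolynomial D))
    (hhat : Polynomial (SkewRank.fixedCenter σ))
    (hh : SkewRank.IsMclm σ n u f h hhat)
    (k : ℕ) (hdegh : SkewRank.deg (h : SkewPolynomial D) = ((k * m : ℕ) : WithBot ℕ)) :
    -- greatest common right divisors with `h` exist
    (∀ a : SkewPolynomial D, ∃ g, SkewRank.IsGCRD g a (h : SkewPolynomial D)) ∧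
    -- `V_f` has a right `B`-basis with `k` elements, where `B = Nuc_r(S_f)`
    Nonempty (Module.Basis (Fin k) (SkewRank.NucR f hf)ᵐᵒᵖ (SkewRank.PetitAlgebra f hf)) ∧
    ∀ e : Module.Basis (Fin k) (SkewRank.NucR f hf)ᵐᵒᵖ (SkewRank.PetitAlgebra f hf),
      -- `a + Rh ↦ M_a` is an isomorphism `R/Rh ≅ M_k(B)`
      (∃ Ψ : (SkewPolynomial D ⧸ Ideal.span {(h : SkewPolynomial D)}) ≃+*
            Matrix (Fin k) (Fin k) (SkewRank.NucR f hf),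
          ∀ a : SkewPolynomial D,
            Ψ (Ideal.Quotient.mk (Ideal.span {(h : SkewPolynomial D)}) a) =
              SkewRank.leftMulMatrix e a) ∧
      -- the dimension of the image of `X ↦ M_a X` and the column rank of `M_a`
      (∀ a g : SkewPolynomial D, SkewRank.IsGCRD g a (h : SkewPolynomial D) →
        (Module.finrank (SkewRank.NucR f hf)ᵐᵒᵖ
            (LinearMap.range (SkewRank.mulLeftMap (SkewRank.leftMulMatrix e a))) : ℚ) =
          (k : ℚ) ^ 2 - (k : ℚ) / m * SkewRank.natDeg g ∧
        (SkewRank.colRank (SkewRank.leftMulMatrix e a) : ℚ) =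
          k - 1 / (m : ℚ) * SkewRank.natDeg g) ∧
      -- if `deg h = dmn`, then `k = dn`, `B ≅ F[x]/(ĥ)`, and `M_a` has rank `dn - deg(g)/m`
      (SkewRank.deg (h : SkewPolynomial D) = ((d * m * n : ℕ) : WithBot ℕ) →
        k = d * n ∧
        ∃ ε : AdjoinRoot hhat ≃+* SkewRank.NucR f hf,
          (∀ p : Polynomial (SkewRank.fixedCenter σ),
            (ε (AdjoinRoot.mk hhat p) : SkewRank.PetitAlgebra f hf) =
              SkewRank.PetitAlgebra.mk f hf (SkewRank.evalCentral σ n u p)) ∧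
          ∀ a g : SkewPolynomial D, SkewRank.IsGCRD g a (h : SkewPolynomial D) →
            (((SkewRank.leftMulMatrix e a).map ε.symm).rank : ℚ) =
              (d : ℚ) * n - 1 / (m : ℚ) * SkewRank.natDeg g) := by
  have hmf : SkewRank.natDeg f = m := SkewRank.natDeg_eq_of_deg_eq hdegf
  have hm' : 1 < SkewRank.natDeg f := hmf ▸ hm
  have hnh : SkewRank.natDeg (h : SkewPolynomial D) = k * m := SkewRank.natDeg_eq_of_deg_eq hdegh
  have hh0 : (h : SkewPolynomial D) ≠ 0 := by
    rw [hh.eq_eval]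
    exact SkewRank.evalCentral_ne_zero hσ hn hu hσu hh.monic.ne_zero
  have := SkewRank.PetitAlgebra.isSimpleModule hf (zero_lt_one.trans hm') hirr
  have := SkewRank.PetitAlgebra.smulCommClass (hf := hf) hm'
  have hB : ∀ c : (SkewRank.NucR f hf)ᵐᵒᵖ, IsUnit c ∨ c = 0 :=
    SkewRank.isUnit_or_eq_zero_of_commutant (A := SkewPolynomial D) (V := SkewRank.PetitAlgebra f hf)
      SkewRank.PetitAlgebra.exists_nucleus_of_linearMap
  obtain ⟨hbasis, hmain⟩ := SkewRank.exists_basis_and_equiv_and_finrank hm' hirr hB hh0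
    (SkewRank.PetitAlgebra.smul_eq_zero_iff_mem_span (hf := hf) hm' hirr hσ hn hu hσu hσn hmin hh)
    (hmf.symm ▸ hnh)
  have hm0 : (m : ℚ) ≠ 0 := by
    exact_mod_cast (zero_lt_one.trans hm).ne'
  refine ⟨fun a => SkewRank.exists_isGCRD a h, hbasis, fun e => ?_⟩
  obtain ⟨hΨ, hrank⟩ := hmain e
  have hcol : ∀ a g : SkewPolynomial D, SkewRank.IsGCRD g a (h : SkewPolynomial D) →
      (SkewRank.colRank (SkewRank.leftMulMatrix e a) : ℚ) =
        k - 1 / (m : ℚ) * SkewRank.natDeg g := by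
    intro a g hg
    have h1 := (hrank a g hg).2
    rw [hmf] at h1
    have h2 : (SkewRank.colRank (SkewRank.leftMulMatrix e a) : ℚ) * m + SkewRank.natDeg g =
        k * m := by exact_mod_cast h1
    field_simp
    linarith
  refine ⟨hΨ, fun a g hg => ⟨?_, hcol a g hg⟩, fun hdeg => ?_⟩
  · rw [(hrank a g hg).1, Nat.cast_mul, hcol a g hg]
    ring
  · have hnh' : SkewRank.natDeg (h : SkewPolynomial D) = d * m * n :=
      SkewRank.natDeg_eq_of_deg_eq hdeg
    have hk : k = d * n := by
      refine Nat.eq_of_mul_eq_mul_right (zero_lt_one.trans hm) ?_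
      rw [← hnh, hnh', mul_right_comm]
    -- Substituting u⁻¹tⁿ multiplies degrees by n, so n deg ĥ = deg h = dmn.
    have hhat_deg : hhat.natDegree = d * m := by
      refine Nat.eq_of_mul_eq_mul_left hn ?_
      rw [← SkewRank.natDeg_evalCentral hσ hn hu hσu hh.monic.ne_zero, ← hh.eq_eval, hnh', mul_comm]
    obtain ⟨hfin, hle⟩ := SkewRank.finite_and_finrank_le hn hu hσn (pow_pos hd 2) hD
    -- The required inequality is [D:F] m ≤ n d² m = (dm)(dn) = deg ĥ · k, using [D:F] = [C:F][D:C]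
    -- ≤ n d².
    obtain ⟨ε, hε⟩ := SkewRank.exists_nucleus_equiv hσ hn hu hσu hσn hh (zero_lt_one.trans hm') hB
      (hk ▸ Nat.mul_pos hd hn) e (by
        rw [hmf, hhat_deg, hk]
        calc Module.finrank (SkewRank.fixedCenter σ) D * m ≤ n * d ^ 2 * m :=
              Nat.mul_le_mul_right m hle
          _ = d * m * (d * n) := by ring)
    refine ⟨hk, ε, hε, fun a g hg => ?_⟩
    rw [SkewRank.rank_map_eq_colRank ε.symm, hcol a g hg, hk, Nat.cast_mul]
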